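/- Let $x=(x_t)_{t\in\mathbb Z}$, $x_t=(x_{t1},\dots,x_{tp})^T$, be a strictly stationary and ergodic $\mathbb R^p$-valued process with finite fourth moments (the independent component model $x_t=\Omega z_t$ with $\Omega=I_p$, so $x=z$). Let $\mathcal T_1,\mathcal T_2$ be finite sets of nonnegative integer lags and $b\in[0,1]$. Put $$\mu_{\tau j}=E(x_{tj}x_{t+\tau,j}),\qquad \nu_{\tau j}=E(x_{tj}^2x_{t+\tau,j}^2)-1,$$ $$D_{jl}=2b\sum_{\tau\in\mathcal T_1}(\mu_{\tau j}-\mu_{\tau l})^2+4(1-b)\sum_{\tau\in\mathcal T_2}\bigl(\nu_{\tau j}^2+\nu_{\tau l}^2-2(\nu_{\tau j}+\nu_{\tau l})\mu_{\tau j}\mu_{\tau l}\bigr),$$ $$c_{jl}=2b\sum_{\tau\in\mathcal T_1}\mu_{\tau j}(\mu_{\tau l}-\mu_{\tau j})+4(1-b)\sum_{\tau\in\mathcal T_2}\bigl(\nu_{\tau l}-\nu_{\tau j}(\nu_{\tau j}+1)+2\nu_{\tau l}\mu_{\tau j}\mu_{\tau l}\bigr).$$ Assume - (A1) $E(x_t)=0$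 and $\mathrm{cov}(x_t)=I_p$; - (A2) the $p$ component series $(x_{t1})_t,\dots,(x_{tp})_t$ are independent; - (A3) $D_{jl}\neq0$ for all $j\neq l$. For $n\ge1$ let $\bar x=\frac1n\sum_{t=1}^n x_t$, let $\hat S=\frac1n\sum_{t=1}^n(x_t-\bar x)(x_t-\bar x)^T$ be the sample covariance matrix, and for $\gamma\in\mathbb R^p$ let $$\hat T(\gamma)=b\,\hat T^s(\gamma)+(1-b)\,\hat T^v(\gamma),$$ $$\hat T^s(\gamma)=\sum_{\tau\in\mathcal T_1}\Bigl(\tfrac1n\sum_{t=1}^{n-\tau}(\gamma^Tx_t)(\gamma^Tx_{t+\tau})\Bigr)\Bigl(\tfrac1n\sum_{t=1}^{n-\tau}\bigl[(\gamma^Tx_{t+\tau})x_t+(\gamma^Tx_t)x_{t+\tau}\bigr]\Bigr),$$ $$\hat T^v(\gamma)=2\sum_{\tau\in\mathcal T_2}\Bigl(\tfrac1n\sum_{t=1}^{n-\tau}\bigl[(\gamma^Tx_t)^2(\gamma^Tx_{t+\tau})^2-1\bigr]\Bigr)\Bigl(\tfrac1n\sum_{t=1}^{n-\tau}\bigl[(\gamma^Tx_t)(\gamma^Tx_{t+\tau})^2x_t+(\gamma^Tx_t)^2(\gamma^Tx_{t+\tau})x_{t+\tau}\bigr]\Bigr),$$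 and $T_j=\hat T(e_j)$, where $e_j$ is the $j$-th unit vector. The gSOBI estimating equations for a $p\times p$ matrix $\Gamma=(\gamma_1,\dots,\gamma_p)^T$ are $$\gamma_j^T\hat T(\gamma_l)=\gamma_l^T\hat T(\gamma_j),\qquad \gamma_j^T\hat S\gamma_l=\delta_{jl},\qquad j,l=1,\dots,p.$$ For $r>0$, a sequence of random matrices $\hat\Gamma=\hat\Gamma_n$ is called a gSOBI estimator ($r$-localized at $I_p$) if, with probability tending to one, $\hat\Gamma$ solves these equations and all entries of $\hat\Gamma-I_p$ are at most $r$ in absolute value. (The equations are invariant under permutations and sign changes of the rows, so a selection of this kind is needed.) Then there is $r>0$ such that a gSOBI estimator localized at $I_p$ exists as a measurable function of $x_1,\dots,x_n$, and every such estimator $\hat\Gamma=(\hat\gamma_{jl})$ satisfies $\hat\Gamma\to_P I_p$. If moreover $\sqrt n(\hat S-I_p)=O_p(1)$ and $\sqrt n\,e_l^TT_j=O_p(1)$ for all $j\ne l$, then $$\sqrt n(\hat\gamma_{jj}-1)=-\tfrac12\sqrt n(\hat S_{jj}-1)+o_p(1)\quad\text{for all }j,$$ $$\sqrt n\,\hat\gamma_{jl}=\bigl(e_l^T\sqrt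 n\,T_j-e_j^T\sqrt n\,T_l+c_{jl}\sqrt n\,\hat S_{jl}\bigr)D_{jl}^{-1}+o_p(1)\quad\text{for all }j\neq l.$$ -/

import Mathlib

open MeasureTheory ProbabilityTheory Filter Topology
open scoped ENNReal

noncomputable section

namespace GSOBI

/-! ### Population quantities -/

/-- Linear autocorrelation `μ_{τ j} = E (z_{t j} z_{t+τ, j})` of a stationary series (at `t = 0`). -/
def linCorr {Ω : Type*} [MeasurableSpace Ω] {p : ℕ} (P : Measure Ω)
    (x : ℤ → Ω → Fin p → ℝ) (τ : ℕ) (j : Fin p) : ℝ :=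
  ∫ ω, x 0 ω j * x (τ : ℤ) ω j ∂P

/-- Quadratic autocorrelation `ν_{τ j} = E (x_{t j}² x_{t+τ, j}²) - 1` (at `t = 0`). -/
def quadCorr {Ω : Type*} [MeasurableSpace Ω] {p : ℕ} (P : Measure Ω)
    (x : ℤ → Ω → Fin p → ℝ) (τ : ℕ) (j : Fin p) : ℝ :=
  (∫ ω, x 0 ω j ^ 2 * x (τ : ℤ) ω j ^ 2 ∂P) - 1

/-- The denominator in the expansion of `γ̂_{jl}`, as a function of the arrays `μ`, `ν`. -/
def denom {p : ℕ} (b : ℝ) (T₁ T₂ : Finset ℕ) (μ ν : ℕ → Fin p → ℝ) (j l : Fin p) : ℝ :=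
  2 * b * ∑ τ ∈ T₁, (μ τ j - μ τ l) ^ 2
    + 4 * (1 - b) * ∑ τ ∈ T₂,
        (ν τ j ^ 2 + ν τ l ^ 2 - 2 * (ν τ j + ν τ l) * μ τ j * μ τ l)

/-- The coefficient of `√n Ŝ_{jl}` in the expansion of `γ̂_{jl}`. -/
def covCoeff {p : ℕ} (b : ℝ) (T₁ T₂ : Finset ℕ) (μ ν : ℕ → Fin p → ℝ) (j l : Fin p) : ℝ :=
  2 * b * ∑ τ ∈ T₁, μ τ j * (μ τ l - μ τ j)
    + 4 * (1 - b) * ∑ τ ∈ T₂,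
        (ν τ l - ν τ j * (ν τ j + 1) + 2 * ν τ l * μ τ j * μ τ l)

/-! ### Sample quantities, for one realization `y` of the series -/

/-- `n⁻¹ ∑_{t = 1}^{n - τ} f t` (an empty sum when `n ≤ τ`). -/
def lagMean (n τ : ℕ) (f : ℤ → ℝ) : ℝ :=
  (n : ℝ)⁻¹ * ∑ t ∈ Finset.Icc 1 (n - τ), f (t : ℤ)

/-- Sample mean vector of `y_1, …, y_n`. -/
def sampleMean {p : ℕ} (n : ℕ) (y : ℤ → Fin p → ℝ) (j : Fin p) : ℝ :=
  lagMean n 0 (fun t => y t j)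

/-- Sample covariance matrix `Ŝ` of `y_1, …, y_n`. -/
def sampleCov {p : ℕ} (n : ℕ) (y : ℤ → Fin p → ℝ) : Matrix (Fin p) (Fin p) ℝ :=
  Matrix.of fun j l =>
    lagMean n 0 (fun t => (y t j - sampleMean n y j) * (y t l - sampleMean n y l))

/-- The linear part of `T̂(γ)`. -/
def Ts {p : ℕ} (T₁ : Finset ℕ) (n : ℕ) (y : ℤ → Fin p → ℝ) (γ : Fin p → ℝ) (i : Fin p) : ℝ :=
  ∑ τ ∈ T₁,
    lagMean n τ (fun t => (γ ⬝ᵥ y t) * (γ ⬝ᵥ y (t + τ)))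
      * lagMean n τ (fun t => (γ ⬝ᵥ y (t + τ)) * y t i + (γ ⬝ᵥ y t) * y (t + τ) i)

/-- The quadratic part of `T̂(γ)`. -/
def Tv {p : ℕ} (T₂ : Finset ℕ) (n : ℕ) (y : ℤ → Fin p → ℝ) (γ : Fin p → ℝ) (i : Fin p) : ℝ :=
  2 * ∑ τ ∈ T₂,
    lagMean n τ (fun t => (γ ⬝ᵥ y t) ^ 2 * (γ ⬝ᵥ y (t + τ)) ^ 2 - 1)
      * lagMean n τ (fun t => (γ ⬝ᵥ y t) * (γ ⬝ᵥ y (t + τ)) ^ 2 * y t i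
          + (γ ⬝ᵥ y t) ^ 2 * (γ ⬝ᵥ y (t + τ)) * y (t + τ) i)

/-- `T̂(γ) = b T̂ˢ(γ) + (1 - b) T̂ᵛ(γ)`. -/
def That {p : ℕ} (b : ℝ) (T₁ T₂ : Finset ℕ) (n : ℕ) (y : ℤ → Fin p → ℝ)
    (γ : Fin p → ℝ) (i : Fin p) : ℝ :=
  b * Ts T₁ n y γ i + (1 - b) * Tv T₂ n y γ i

/-- `T_j = T̂(e_j)`. -/
def Tvec {p : ℕ} (b : ℝ) (T₁ T₂ : Finset ℕ) (n : ℕ) (y : ℤ → Fin p → ℝ) (j : Fin p) :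
    Fin p → ℝ :=
  That b T₁ T₂ n y (Pi.single j 1)

/-- The sample estimating equations: with `γ_j` the `j`-th row of `Γ`,
`γ_jᵀ T̂(γ_l) = γ_lᵀ T̂(γ_j)` and `γ_jᵀ Ŝ γ_l = δ_{jl}` for all `j`, `l`. -/
def SolvesEstEq {p : ℕ} (b : ℝ) (T₁ T₂ : Finset ℕ) (n : ℕ) (y : ℤ → Fin p → ℝ)
    (Γ : Matrix (Fin p) (Fin p) ℝ) : Prop :=
  (∀ j l, Γ j ⬝ᵥ That b T₁ T₂ n y (Γ l) = Γ l ⬝ᵥ That b T₁ T₂ n y (Γ j)) ∧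
  (∀ j l, Γ j ⬝ᵥ (sampleCov n y).mulVec (Γ l) = if j = l then 1 else 0)

/-! ### Asymptotic notions -/

/-- `X_n = O_p(1)`. -/
def BddInProb {Ω : Type*} [MeasurableSpace Ω] (P : Measure Ω) (X : ℕ → Ω → ℝ) : Prop :=
  ∀ ε : ℝ≥0∞, 0 < ε → ∃ M : ℝ, ∀ᶠ n in atTop, P {ω | M < |X n ω|} ≤ ε

/-- `Γ̂_n` is a gSOBI estimator based on `x_1, …, x_n`, the signs and the order of its rows being
fixed by the requirement that it lies within `r` of the identity: with probability tending to one
it solves the estimating equations and all its entries are within `r` of those of `I_p`. (The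
equations are invariant under signed permutations of the rows, so they never determine `Γ̂_n`
without such a choice.) -/
def IsEstimator {Ω : Type*} [MeasurableSpace Ω] {p : ℕ} (P : Measure Ω) (b : ℝ)
    (T₁ T₂ : Finset ℕ) (x : ℤ → Ω → Fin p → ℝ) (r : ℝ)
    (Γ : ℕ → Ω → Matrix (Fin p) (Fin p) ℝ) : Prop :=
  Tendsto (fun n => P {ω | ¬ (SolvesEstEq b T₁ T₂ n (fun t => x t ω) (Γ n ω) ∧
      ∀ i j, |Γ n ω i j - (1 : Matrix (Fin p) (Fin p) ℝ) i j| ≤ r)}) atTop (𝓝 0)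

end GSOBI

end

/-!
The estimating equations are polynomial in `Γ` and in finitely many lagged sample moments, so that
`Γ̂` is an implicit function of these moments. The ergodic theorem makes the sample moments converge
to the population moments, at which `I_p` is a solution. There the derivative with respect to `Γ`
couples only the entries `(j, l)` and `(l, j)`, through a 2 × 2 system of determinant `2 D_{jl}`,
so (A3) makes it invertible. The implicit function theorem then gives existence, uniqueness near
`I_p` and consistency, and solving the linearized equations gives the expansions.
-/

noncomputable section

namespace GSOBI

/-! ### Convergence in probability along a filter -/

section Probability

variable {Ω : Type*} [MeasurableSpace Ω] {P : Measure Ω}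

/-- The filter on `ℕ × Ω` of the sequences of events whose probability tends to one. Limits and
asymptotic relations along it are limits and asymptotic relations in probability. -/
def probFilter (P : Measure Ω) : Filter (ℕ × Ω) :=
  comk (fun A => Tendsto (fun n => P {ω | (n, ω) ∈ A}) atTop (𝓝 0)) (by simp)
    (fun _ hA _ hBA => tendsto_of_tendsto_of_tendsto_of_le_of_le tendsto_const_nhds hA
      (fun _ => zero_le) fun _ => measure_mono fun _ hω => hBA hω)
    (fun A hA B hB => tendsto_of_tendsto_of_tendsto_of_le_of_le tendsto_const_nhds
      (by simpa only [add_zero] using hA.add hB) (fun _ => zero_le)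
      fun n => measure_union_le {ω | (n, ω) ∈ A} {ω | (n, ω) ∈ B})

theorem eventually_probFilter {q : ℕ × Ω → Prop} :
    (∀ᶠ z in probFilter P, q z) ↔ Tendsto (fun n => P {ω | ¬ q (n, ω)}) atTop (𝓝 0) :=
  Iff.rfl

theorem tendsto_fst_probFilter : Tendsto Prod.fst (probFilter P) atTop := by
  refine tendsto_def.2 fun s hs => tendsto_const_nhds.congr' ?_
  filter_upwards [hs] with n hn
  simp [hn]

theorem tendsto_probFilter_iff_tendstoInMeasure {E : Type*} [PseudoMetricSpace E]
    {f : ℕ → Ω → E} {c : E} :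
    Tendsto (fun z : ℕ × Ω => f z.1 z.2) (probFilter P) (𝓝 c) ↔
      TendstoInMeasure P f atTop (fun _ => c) := by
  simp only [tendstoInMeasure_iff_dist, Metric.tendsto_nhds, eventually_probFilter, not_lt]

theorem BddInProb.mono {X Y : ℕ → Ω → ℝ} (hY : BddInProb P Y)
    (hXY : ∀ n ω, |X n ω| ≤ |Y n ω|) : BddInProb P X := fun ε hε =>
  (hY ε hε).imp fun _ hM => hM.mono fun n hn =>
    (measure_mono fun ω (hω : _ < _) => hω.trans_le (hXY n ω)).trans hn

theorem BddInProb.add {X Y : ℕ → Ω → ℝ} (hX : BddInProb P X) (hY : BddInProb P Y) :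
    BddInProb P fun n ω => X n ω + Y n ω := by
  intro ε hε
  obtain ⟨M, hM⟩ := hX (ε / 2) (ENNReal.half_pos hε.ne')
  obtain ⟨N, hN⟩ := hY (ε / 2) (ENNReal.half_pos hε.ne')
  refine ⟨M + N, ?_⟩
  filter_upwards [hM, hN] with n hMn hNn
  have hsub : {ω | M + N < |X n ω + Y n ω|} ⊆ {ω | M < |X n ω|} ∪ {ω | N < |Y n ω|} := by
    intro ω hω
    by_contra! h
    simp only [Set.mem_union, Set.mem_ofPred_eq, not_or, not_lt] at h hω
    linarith [abs_add_le (X n ω) (Y n ω)]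
  calc P {ω | M + N < |X n ω + Y n ω|}
      ≤ P {ω | M < |X n ω|} + P {ω | N < |Y n ω|} :=
        (measure_mono hsub).trans (measure_union_le _ _)
    _ ≤ ε / 2 + ε / 2 := add_le_add hMn hNn
    _ = ε := ENNReal.add_halves ε

theorem BddInProb.sum {ι : Type*} {X : ι → ℕ → Ω → ℝ} {s : Finset ι}
    (hX : ∀ i ∈ s, BddInProb P (X i)) : BddInProb P fun n ω => ∑ i ∈ s, X i n ω := by
  classical
  induction s using Finset.induction_on with
  | empty => exact fun ε _ => ⟨0, by simp⟩
  | insert i s hi ih =>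
    simp only [Finset.sum_insert hi]
    exact (hX i (s.mem_insert_self i)).add (ih fun k hk => hX k (Finset.mem_insert_of_mem hk))

theorem BddInProb.norm_pi {ι : Type*} [Fintype ι] {E : ι → Type*}
    [∀ i, SeminormedAddCommGroup (E i)] {X : ℕ → Ω → ∀ i, E i}
    (hX : ∀ i, BddInProb P fun n ω => ‖X n ω i‖) : BddInProb P fun n ω => ‖X n ω‖ := by
  refine (BddInProb.sum fun i (_ : i ∈ Finset.univ) => hX i).mono fun n ω => ?_
  rw [abs_norm, abs_of_nonneg (Finset.sum_nonneg fun _ _ => norm_nonneg _),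
    pi_norm_le_iff_of_nonneg (Finset.sum_nonneg fun _ _ => norm_nonneg _)]
  exact fun i => Finset.single_le_sum (f := fun i => ‖X n ω i‖) (fun _ _ => norm_nonneg _)
    (Finset.mem_univ i)

theorem BddInProb.tendsto_mul_zero {u : ℕ × Ω → ℝ} {X : ℕ → Ω → ℝ}
    (hu : Tendsto u (probFilter P) (𝓝 0)) (hX : BddInProb P X) :
    Tendsto (fun z => u z * X z.1 z.2) (probFilter P) (𝓝 0) := by
  rw [Metric.tendsto_nhds]
  intro ε hε
  rw [eventually_probFilter, ENNReal.tendsto_nhds_zero]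
  intro δ hδ
  obtain ⟨M, hM⟩ := hX (δ / 2) (ENNReal.half_pos hδ.ne')
  have hu_small := Metric.tendsto_nhds.1 hu (ε / (|M| + 1)) (by positivity)
  rw [eventually_probFilter, ENNReal.tendsto_nhds_zero] at hu_small
  filter_upwards [hM, hu_small _ (ENNReal.half_pos hδ.ne')] with n hXn hun
  have hsub : {ω | ¬ dist (u (n, ω) * X n ω) 0 < ε} ⊆
      {ω | M < |X n ω|} ∪ {ω | ¬ dist (u (n, ω)) 0 < ε / (|M| + 1)} := by
    intro ω hω
    by_contra! h
    simp only [Set.mem_union, Set.mem_ofPred_eq, not_or, not_lt, not_le, dist_zero_right,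
      Real.norm_eq_abs, abs_mul] at h hω
    refine hω.not_gt ?_
    calc |u (n, ω)| * |X n ω| ≤ |u (n, ω)| * (|M| + 1) := by
          gcongr
          linarith [h.1, le_abs_self M]
      _ < ε := (lt_div_iff₀ (by positivity)).1 h.2
  calc P {ω | ¬ dist (u (n, ω) * X n ω) 0 < ε}
      ≤ P {ω | M < |X n ω|} + P {ω | ¬ dist (u (n, ω)) 0 < ε / (|M| + 1)} :=
        (measure_mono hsub).trans (measure_union_le _ _)
    _ ≤ δ / 2 + δ / 2 := add_le_add hXn hun
    _ = δ := ENNReal.add_halves δ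

theorem BddInProb.tendsto_smul_zero_of_isLittleO {E F : Type*} [NormedAddCommGroup E]
    [NormedSpace ℝ E] [NormedAddCommGroup F] [NormedSpace ℝ F] {u : ℕ × Ω → E} {v : ℕ × Ω → F}
    {a : ℕ → ℝ} (hv : BddInProb P fun n ω => ‖a n • v (n, ω)‖) (huv : u =o[probFilter P] v) :
    Tendsto (fun z => a z.1 • u z) (probFilter P) (𝓝 0) := by
  obtain ⟨c, hc, huc⟩ := Asymptotics.isLittleO_iff_exists_eq_mul.1 huv.norm_norm
  rw [tendsto_zero_iff_norm_tendsto_zero]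
  refine (hv.tendsto_mul_zero hc).congr' ?_
  filter_upwards [huc] with z hz
  rw [norm_smul, norm_smul, hz, Pi.mul_apply, mul_left_comm]

end Probability

/-! ### The mean ergodic theorem -/

section Ergodic

variable {α E : Type*} {S : α → α} [NormedAddCommGroup E]

section NormedSpace

variable [NormedSpace ℝ E] {f : α → E}

theorem birkhoffAverage_eq_smul_sum_comp (n : ℕ) :
    birkhoffAverage ℝ S f n = (n : ℝ)⁻¹ • ∑ k ∈ Finset.range n, f ∘ S^[k] := by
  ext a
  simp only [birkhoffAverage, birkhoffSum, Pi.smul_apply, Finset.sum_apply, Function.comp_apply]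

variable [MeasurableSpace α] {μ : Measure α} {q : ℝ≥0∞}

theorem aestronglyMeasurable_birkhoffAverage (hS : MeasurePreserving S μ μ)
    (hf : AEStronglyMeasurable f μ) (n : ℕ) :
    AEStronglyMeasurable (birkhoffAverage ℝ S f n) μ := by
  rw [birkhoffAverage_eq_smul_sum_comp]
  exact (Finset.aestronglyMeasurable_sum _ fun k _ =>
    hf.comp_measurePreserving (hS.iterate k)).const_smul _

theorem eLpNorm_birkhoffAverage_le (hS : MeasurePreserving S μ μ)
    (hf : AEStronglyMeasurable f μ) (hq : 1 ≤ q) (n : ℕ) :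
    eLpNorm (birkhoffAverage ℝ S f n) q μ ≤ eLpNorm f q μ := by
  have hsum : eLpNorm (∑ k ∈ Finset.range n, f ∘ S^[k]) q μ ≤ n * eLpNorm f q μ :=
    calc eLpNorm (∑ k ∈ Finset.range n, f ∘ S^[k]) q μ
        ≤ ∑ k ∈ Finset.range n, eLpNorm (f ∘ S^[k]) q μ :=
          eLpNorm_sum_le (fun k _ => hf.comp_measurePreserving (hS.iterate k)) hq
      _ = n * eLpNorm f q μ := by
          simp only [eLpNorm_comp_measurePreserving hf (hS.iterate _), Finset.sum_const,
            Finset.card_range, nsmul_eq_mul]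
  rcases eq_or_ne n 0 with rfl | hn
  · simp
  calc eLpNorm (birkhoffAverage ℝ S f n) q μ
      = (n : ℝ≥0∞)⁻¹ * eLpNorm (∑ k ∈ Finset.range n, f ∘ S^[k]) q μ := by
        rw [birkhoffAverage_eq_smul_sum_comp, eLpNorm_const_smul, enorm_inv (by positivity)]
        simp
    _ ≤ (n : ℝ≥0∞)⁻¹ * (n * eLpNorm f q μ) := by gcongr
    _ = eLpNorm f q μ := by
        rw [← mul_assoc, ENNReal.inv_mul_cancel (by simpa using hn) (by simp), one_mul]

theorem coeFn_birkhoffAverage_compMeasurePreserving (hS : MeasurePreserving S μ μ) (F : Lp E q μ)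
    (n : ℕ) :
    ⇑(birkhoffAverage ℝ (Lp.compMeasurePreserving S hS) _root_.id n F) =ᵐ[μ]
      birkhoffAverage ℝ S F n := by
  have hiter (k : ℕ) : ⇑((Lp.compMeasurePreserving S hS)^[k] F) =ᵐ[μ] F ∘ S^[k] := by
    rw [Lp.compMeasurePreserving_iterate]
    exact Lp.coeFn_compMeasurePreserving F _
  rw [birkhoffAverage_eq_smul_sum_comp]
  refine (Lp.coeFn_smul _ _).trans (.const_smul ((Lp.coeFn_finsetSum _ _).trans ?_) _)
  simpa only [Finset.sum_fn, id_eq] using eventuallyEq_sum fun k _ => hiter k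

end NormedSpace

variable [InnerProductSpace ℝ E] [CompleteSpace E] [MeasurableSpace α] {μ : Measure α}
  [IsProbabilityMeasure μ] {f : α → E}

theorem inner_const_sub_const_integral (c : E) (F : Lp E 2 μ) :
    inner ℝ (Lp.const 2 μ c) (F - Lp.const 2 μ (∫ a, F a ∂μ)) = 0 := by
  have hinner (G : Lp E 2 μ) : inner ℝ (Lp.const 2 μ c) G = inner ℝ c (∫ a, G a ∂μ) := by
    rw [← indicatorConstLp_univ, L2.inner_indicatorConstLp_eq_inner_setIntegral,
      setIntegral_univ]
  have hconst : ∫ a, Lp.const 2 μ (∫ a, F a ∂μ) a ∂μ = ∫ a, F a ∂μ := by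
    rw [integral_congr_ae (Lp.coeFn_const _ _ _)]
    simp
  rw [inner_sub_right, hinner, hinner, hconst, sub_self]

theorem tendsto_birkhoffAverage_Lp_two (hS : Ergodic S μ) (F : Lp E 2 μ) :
    Tendsto (fun n => birkhoffAverage ℝ (Lp.compMeasurePreserving S hS.toMeasurePreserving)
      _root_.id n F) atTop (𝓝 (Lp.const 2 μ (∫ a, F a ∂μ))) := by
  set U := Lp.compMeasurePreservingₗᵢ ℝ (p := 2) (E := E) S hS.toMeasurePreserving
  have hfixed (c : E) : U (Lp.const 2 μ c) = Lp.const 2 μ c := by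
    rw [← indicatorConstLp_univ]
    exact Lp.indicatorConstLp_compMeasurePreserving .univ _ c hS.toMeasurePreserving
  have hconst {G : Lp E 2 μ} (hG : U G = G) : ∃ c, G = Lp.const 2 μ c := by
    have hGS : ⇑(U G) =ᵐ[μ] G ∘ S := Lp.coeFn_compMeasurePreserving G hS.toMeasurePreserving
    rw [hG] at hGS
    obtain ⟨c, hc⟩ := hS.ae_eq_const_of_ae_eq_comp_ae (Lp.aestronglyMeasurable G) hGS.symm
    exact ⟨c, Lp.ext (hc.trans (Lp.coeFn_const _ _ _).symm)⟩
  have hproj : (U.toContinuousLinearMap.eqLocus (1 : Lp E 2 μ →L[ℝ] Lp E 2 μ)).starProjection F =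
      Lp.const 2 μ (∫ a, F a ∂μ) := by
    refine Submodule.eq_starProjection_of_mem_of_inner_eq_zero (hfixed _) fun G hG => ?_
    obtain ⟨c, rfl⟩ := hconst hG
    rw [real_inner_comm, inner_const_sub_const_integral]
  rw [← hproj]
  exact U.toContinuousLinearMap.tendsto_birkhoffAverage_orthogonalProjection
    U.norm_toContinuousLinearMap_le F

theorem tendsto_eLpNorm_two_birkhoffAverage (hS : Ergodic S μ) (hf : MemLp f 2 μ) :
    Tendsto (fun n => eLpNorm (fun a => birkhoffAverage ℝ S f n a - ∫ y, f y ∂μ) 2 μ)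
      atTop (𝓝 0) := by
  refine ((Lp.tendsto_Lp_iff_tendsto_eLpNorm' _ _).1
    (tendsto_birkhoffAverage_Lp_two hS (hf.toLp f))).congr fun n => eLpNorm_congr_ae ?_
  have hiter : ∀ᵐ a ∂μ, ∀ k, hf.toLp f (S^[k] a) = f (S^[k] a) := ae_all_iff.2 fun k =>
    (hS.toMeasurePreserving.iterate k).quasiMeasurePreserving.ae hf.coeFn_toLp
  filter_upwards [coeFn_birkhoffAverage_compMeasurePreserving hS.toMeasurePreserving (hf.toLp f) n,
    Lp.coeFn_const 2 μ (∫ y, hf.toLp f y ∂μ), hiter] with a havg hc hk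
  rw [Pi.sub_apply, havg, hc, Function.const_apply, integral_congr_ae hf.coeFn_toLp]
  simp only [birkhoffAverage, birkhoffSum, hk]

theorem tendsto_eLpNorm_one_birkhoffAverage (hS : Ergodic S μ) (hf : Integrable f μ) :
    Tendsto (fun n => eLpNorm (fun a => birkhoffAverage ℝ S f n a - ∫ y, f y ∂μ) 1 μ)
      atTop (𝓝 0) := by
  rw [ENNReal.tendsto_nhds_zero]
  intro ε hε
  have hε3 : ε / 3 ≠ 0 := (ENNReal.div_pos hε.ne' (by simp)).ne'
  obtain ⟨g, hfg, hg1⟩ := (memLp_one_iff_integrable.2 hf).exists_simpleFunc_eLpNorm_sub_lt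
    ENNReal.one_ne_top hε3
  have hg : Integrable g μ := memLp_one_iff_integrable.1 hg1
  have hlim := tendsto_eLpNorm_two_birkhoffAverage hS (g.memLp_of_isFiniteMeasure 2 μ)
  filter_upwards [ENNReal.tendsto_nhds_zero.1 hlim _ (pos_iff_ne_zero.2 hε3)] with n hn
  have hmeas {h : α → E} (hh : Integrable h μ) :=
    aestronglyMeasurable_birkhoffAverage hS.toMeasurePreserving hh.aestronglyMeasurable n
  have hsplit : (fun a => birkhoffAverage ℝ S f n a - ∫ y, f y ∂μ) =
      birkhoffAverage ℝ S (f - ⇑g) n + (fun a => birkhoffAverage ℝ S g n a - ∫ y, g y ∂μ) +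
        fun _ => ∫ y, g y - f y ∂μ := by
    ext a
    simp only [birkhoffAverage_sub, integral_sub hg hf, Pi.add_apply, Pi.sub_apply]
    abel
  have hgm := (hmeas hg).sub (aestronglyMeasurable_const (b := ∫ y, g y ∂μ))
  have havg : eLpNorm (birkhoffAverage ℝ S (f - ⇑g) n) 1 μ ≤ ε / 3 :=
    (eLpNorm_birkhoffAverage_le hS.toMeasurePreserving (hf.sub hg).aestronglyMeasurable le_rfl
      n).trans hfg.le
  have hsimple : eLpNorm (fun a => birkhoffAverage ℝ S g n a - ∫ y, g y ∂μ) 1 μ ≤ ε / 3 :=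
    (eLpNorm_le_eLpNorm_of_exponent_le one_le_two hgm).trans hn
  have hmean : eLpNorm (fun _ : α => ∫ y, g y - f y ∂μ) 1 μ ≤ ε / 3 :=
    calc eLpNorm (fun _ : α => ∫ y, g y - f y ∂μ) 1 μ = ‖∫ y, g y - f y ∂μ‖ₑ := by
          simp [eLpNorm_one_eq_lintegral_enorm]
      _ ≤ eLpNorm (⇑g - f) 1 μ := by
          rw [eLpNorm_one_eq_lintegral_enorm]
          exact enorm_integral_le_lintegral_enorm _
      _ ≤ ε / 3 := by rw [eLpNorm_sub_comm]; exact hfg.le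
  calc eLpNorm (fun a => birkhoffAverage ℝ S f n a - ∫ y, f y ∂μ) 1 μ
      ≤ ε / 3 + ε / 3 + ε / 3 := by
        rw [hsplit]
        refine (eLpNorm_add_le ((hmeas (hf.sub hg)).add hgm) aestronglyMeasurable_const
          le_rfl).trans (add_le_add ?_ hmean)
        exact (eLpNorm_add_le (hmeas (hf.sub hg)) hgm le_rfl).trans (add_le_add havg hsimple)
    _ = ε := ENNReal.add_thirds ε

end Ergodic

/-! ### Lagged sample means -/

section LagMean

variable {β : Type*}

theorem iterate_shift (y : ℤ → β) (k : ℕ) :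
    (fun (y : ℤ → β) (t : ℤ) => y (t + 1))^[k] y = fun t => y (t + k) := by
  induction k with
  | zero => simp
  | succ k ih =>
    rw [Function.iterate_succ_apply', ih]
    simp only [Nat.cast_succ, add_assoc, add_comm (1 : ℤ)]

theorem lagMean_eq_birkhoffAverage (g : (ℤ → β) → ℝ) (n τ : ℕ) (y : ℤ → β) :
    lagMean n τ (fun t => g fun s => y (s + t)) = ((n - τ : ℕ) : ℝ) / n *
      birkhoffAverage ℝ (fun (y : ℤ → β) (t : ℤ) => y (t + 1)) g (n - τ) (fun t => y (t + 1)) := by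
  have hsum : ∑ t ∈ Finset.Icc 1 (n - τ), g (fun s => y (s + (t : ℤ))) =
      birkhoffSum (fun (y : ℤ → β) (t : ℤ) => y (t + 1)) g (n - τ) (fun t => y (t + 1)) := by
    rw [← Finset.Ico_add_one_right_eq_Icc, Finset.sum_Ico_eq_sum_range]
    refine Finset.sum_congr rfl fun k _ => ?_
    rw [iterate_shift]
    simp only [Nat.cast_add, Nat.cast_one, add_assoc, add_comm (1 : ℤ)]
  rw [lagMean, hsum, birkhoffAverage, smul_eq_mul, ← mul_assoc]
  rcases eq_or_ne (n - τ) 0 with h | h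
  · simp [h]
  · field_simp

theorem tendsto_natCast_tsub_div_natCast (τ : ℕ) :
    Tendsto (fun n : ℕ => ((n - τ : ℕ) : ℝ) / n) atTop (𝓝 1) := by
  have h : Tendsto (fun n : ℕ => 1 - (τ : ℝ) / n) atTop (𝓝 1) := by
    simpa using tendsto_const_nhds.sub (tendsto_const_div_atTop_nhds_zero_nat (τ : ℝ))
  refine h.congr' ?_
  filter_upwards [eventually_ge_atTop τ, eventually_gt_atTop 0] with n hτ hn
  rw [Nat.cast_sub hτ]
  field_simp

theorem tendsto_lagMean {Ω : Type*} [MeasurableSpace Ω] {P : Measure Ω} [IsProbabilityMeasure P]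
    [MeasurableSpace β] {x : ℤ → Ω → β} (hmeas : ∀ t, Measurable (x t))
    (herg : Ergodic (fun (y : ℤ → β) (t : ℤ) => y (t + 1)) (P.map fun ω (t : ℤ) => x t ω))
    (τ : ℕ) {g : (ℤ → β) → ℝ} (hg : Measurable g)
    (hint : Integrable (fun ω => g fun t => x t ω) P) :
    Tendsto (fun z : ℕ × Ω => lagMean z.1 τ fun t => g fun s => x (s + t) z.2) (probFilter P)
      (𝓝 (∫ ω, g (fun t => x t ω) ∂P)) := by
  set S : (ℤ → β) → ℤ → β := fun y t => y (t + 1)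
  set X : Ω → ℤ → β := fun ω t => x t ω
  set Q : Measure (ℤ → β) := P.map X
  have hX : Measurable X := measurable_pi_lambda _ hmeas
  have hQ : IsProbabilityMeasure Q := Measure.isProbabilityMeasure_map hX.aemeasurable
  have hgQ : Integrable g Q :=
    (integrable_map_measure hg.aestronglyMeasurable hX.aemeasurable).2 hint
  have hSX : MeasurePreserving (S ∘ X) P Q := herg.toMeasurePreserving.comp ⟨hX, rfl⟩
  have havgm (n : ℕ) : AEStronglyMeasurable (birkhoffAverage ℝ S g n) Q :=
    aestronglyMeasurable_birkhoffAverage herg.toMeasurePreserving hgQ.aestronglyMeasurable n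
  have havg : TendstoInMeasure P (fun n ω => birkhoffAverage ℝ S g (n - τ) (S (X ω))) atTop
      fun _ => ∫ y, g y ∂Q := by
    refine tendstoInMeasure_of_tendsto_eLpNorm one_ne_zero
      (fun n => (havgm _).comp_measurePreserving hSX) aestronglyMeasurable_const ?_
    refine ((tendsto_eLpNorm_one_birkhoffAverage herg hgQ).comp
      (tendsto_sub_atTop_nat τ)).congr fun n => ?_
    exact (eLpNorm_comp_measurePreserving ((havgm _).sub aestronglyMeasurable_const) hSX).symm
  have hmul := ((tendsto_natCast_tsub_div_natCast τ).comp (tendsto_fst_probFilter (P := P))).mul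
    (tendsto_probFilter_iff_tendstoInMeasure.2 havg)
  rw [one_mul, integral_map hX.aemeasurable hg.aestronglyMeasurable] at hmul
  exact hmul.congr fun z => (lagMean_eq_birkhoffAverage g z.1 τ (X z.2)).symm

end LagMean

/-! ### Solutions of a parametrised equation -/

section ImplicitFunction

variable {E X Y : Type*} [NormedAddCommGroup E] [NormedSpace ℝ E] [NormedAddCommGroup X]
  [NormedSpace ℝ X] [NormedAddCommGroup Y] [NormedSpace ℝ Y] {F : E × X → Y} {m₀ : E} {x₀ : X}

theorem exists_local_solution [CompleteSpace E] [CompleteSpace X] [CompleteSpace Y]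
    (hF : ContDiffAt ℝ 1 F (m₀, x₀))
    (hinv : (fderiv ℝ F (m₀, x₀) ∘L .inr ℝ E X).IsInvertible) (h₀ : F (m₀, x₀) = 0) :
    ∃ r > 0, ∃ V : Set E, IsOpen V ∧ m₀ ∈ V ∧ ∃ φ : E → X, ContinuousOn φ V ∧
      ∀ m ∈ V, ∀ x, F (m, x) = 0 ∧ dist x x₀ ≤ r ↔ x = φ m := by
  set φ := hF.implicitFunction one_ne_zero hinv
  have hφ : ContDiffAt ℝ 1 φ m₀ := hF.contDiffAt_implicitFunction one_ne_zero hinv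
  have hiff := hF.eventually_apply_eq_iff_implicitFunction one_ne_zero hinv
  rw [h₀, nhds_prod_eq] at hiff
  obtain ⟨q, hq, s, hs, hqs⟩ := eventually_prod_iff.1 hiff
  obtain ⟨r, hr, hball⟩ := Metric.nhds_basis_closedBall.mem_iff.1 hs
  have hφ_near : ∀ᶠ m in 𝓝 m₀, dist (φ m) x₀ ≤ r := by
    have hlim : Tendsto φ (𝓝 m₀) (𝓝 x₀) := by
      simpa only [φ, hF.implicitFunction_apply_self one_ne_zero hinv] using hφ.continuousAt.tendsto
    exact hlim.eventually (Metric.closedBall_mem_nhds _ hr)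
  have hφ_cont : ∀ᶠ m in 𝓝 m₀, ContinuousAt φ m :=
    (hφ.eventually (by simp)).mono fun m h => h.continuousAt
  obtain ⟨V, hV, hVo, hmV⟩ := eventually_nhds_iff.1 ((hq.and hφ_near).and hφ_cont)
  refine ⟨r, hr, V, hVo, hmV, φ, fun m hm => (hV m hm).2.continuousWithinAt, fun m hm x => ?_⟩
  obtain ⟨⟨hqm, hφm⟩, -⟩ := hV m hm
  constructor
  · rintro ⟨hx, hxr⟩
    exact ((hqs hqm (hball hxr)).1 hx).symm
  · rintro rfl
    exact ⟨(hqs hqm (hball hφm)).2 rfl, hφm⟩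

variable {Z : Type*} {𝓛 : Filter Z} {m : Z → E} {x : Z → X} {F' : E × X →L[ℝ] Y}

theorem isLittleO_sub_of_solution (hF : HasStrictFDerivAt F F' (m₀, x₀))
    (hm : Tendsto m 𝓛 (𝓝 m₀)) (hx : Tendsto x 𝓛 (𝓝 x₀)) (hsol : ∀ᶠ z in 𝓛, F (m z, x z) = 0) :
    (fun z => F (m z, x₀) + F' (0, x z - x₀)) =o[𝓛] fun z => x z - x₀ := by
  have hpairs : Tendsto (fun z => ((m z, x₀), (m z, x z))) 𝓛 (𝓝 ((m₀, x₀), (m₀, x₀))) :=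
    (hm.prodMk_nhds tendsto_const_nhds).prodMk_nhds (hm.prodMk_nhds hx)
  have hzero : (fun z => F (m z, x₀) - F (m z, x z) - F' ((m z, x₀) - (m z, x z))) =o[𝓛]
      fun z => (m z, x₀) - (m z, x z) := hF.isLittleO.comp_tendsto hpairs
  refine (hzero.congr' ?_ .rfl).trans_isBigO (.of_bound 1 (.of_forall fun z => ?_))
  · filter_upwards [hsol] with z hz
    have hneg : (m z, x₀) - (m z, x z) = -(0, x z - x₀) := by simp
    rw [hz, hneg, map_neg]
    abel
  · simp [Prod.norm_def, norm_sub_rev]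

theorem isLittleO_of_solution (hF : HasStrictFDerivAt F F' (m₀, x₀))
    (hinv : (F' ∘L .inr ℝ E X).IsInvertible) (hm : Tendsto m 𝓛 (𝓝 m₀))
    (hx : Tendsto x 𝓛 (𝓝 x₀)) (hsol : ∀ᶠ z in 𝓛, F (m z, x z) = 0) :
    (fun z => F (m z, x₀) + F' (0, x z - x₀)) =o[𝓛] fun z => F (m z, x₀) := by
  obtain ⟨e, he⟩ := hinv
  have hsub := isLittleO_sub_of_solution hF hm hx hsol
  have happly (z : Z) : e (x z - x₀) = F' (0, x z - x₀) := by
    rw [← ContinuousLinearEquiv.coe_coe, he]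
    rfl
  have hinverse : (fun z => x z - x₀) =O[𝓛] fun z => F' (0, x z - x₀) := by
    simpa only [← happly] using e.isBigO_comp_rev (fun z => x z - x₀) 𝓛
  have hderiv := (hsub.trans_isBigO hinverse).right_isBigO_sub
  simp only [sub_add_cancel_right, Asymptotics.isBigO_neg_right] at hderiv
  exact hsub.trans_isBigO (hinverse.trans hderiv)

end ImplicitFunction

/-! ### The estimating equations as polynomial equations in moments -/

section MomentEquations

variable {p : ℕ} {T₁ T₂ : Finset ℕ}

/-- The moments entering the estimating equations: lagged second moments, lagged fourth moments,
lagged means of the constant `1` and the covariance matrix. The third component records that a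
sample mean at lag `τ` averages only `n - τ` of the `n` terms. A product, not a structure, so that
the implicit function theorem applies. -/
abbrev Moments (p : ℕ) (T₁ T₂ : Finset ℕ) : Type :=
  (T₁ → Fin p → Fin p → ℝ) × (T₂ → Fin p → Fin p → Fin p → Fin p → ℝ) × (T₂ → ℝ) ×
    (Fin p → Fin p → ℝ)

/-- Lagged second moments `E (x_{t i} x_{t+τ, k})`. -/
abbrev Moments.second (m : Moments p T₁ T₂) : T₁ → Fin p → Fin p → ℝ := m.1

/-- Lagged fourth moments `E (x_{t i} x_{t k} x_{t+τ, u} x_{t+τ, v})`. -/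
abbrev Moments.fourth (m : Moments p T₁ T₂) : T₂ → Fin p → Fin p → Fin p → Fin p → ℝ := m.2.1

/-- Lagged means of the constant `1`. -/
abbrev Moments.mass (m : Moments p T₁ T₂) : T₂ → ℝ := m.2.2.1

/-- The covariance matrix. -/
abbrev Moments.cov (m : Moments p T₁ T₂) : Fin p → Fin p → ℝ := m.2.2.2

/-- Linear autocorrelation of the projection `γᵀ x`, from the lagged second moments `M` of `x`. -/
def linA (M : Fin p → Fin p → ℝ) (γ : Fin p → ℝ) : ℝ :=
  γ ⬝ᵥ fun i => γ ⬝ᵥ fun k => M i k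

/-- The gradient of the linear autocorrelation `linA M`. -/
def linB (M : Fin p → Fin p → ℝ) (γ : Fin p → ℝ) (i : Fin p) : ℝ :=
  (γ ⬝ᵥ fun k => M i k) + γ ⬝ᵥ fun k => M k i

/-- Quadratic autocorrelation of the projection `γᵀ x`, from the lagged fourth moments `Q` of `x`
and the lagged mean `c` of the constant `1`. -/
def quadA (Q : Fin p → Fin p → Fin p → Fin p → ℝ) (c : ℝ) (γ : Fin p → ℝ) : ℝ :=
  (γ ⬝ᵥ fun i => γ ⬝ᵥ fun k => γ ⬝ᵥ fun u => γ ⬝ᵥ fun v => Q i k u v) - c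

/-- Half the gradient of the quadratic autocorrelation `quadA Q c`, for lagged fourth moments `Q`,
which are symmetric in the first two and in the last two indices. -/
def quadB (Q : Fin p → Fin p → Fin p → Fin p → ℝ) (γ : Fin p → ℝ) (i : Fin p) : ℝ :=
  (γ ⬝ᵥ fun k => γ ⬝ᵥ fun u => γ ⬝ᵥ fun v => Q i k u v)
    + γ ⬝ᵥ fun k => γ ⬝ᵥ fun u => γ ⬝ᵥ fun v => Q u v i k

/-- `T̂(γ)` as a function of the moments. -/
def momentT (b : ℝ) (m : Moments p T₁ T₂) (γ : Fin p → ℝ) (i : Fin p) : ℝ :=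
  b * ∑ τ : T₁, linA (m.second τ) γ * linB (m.second τ) γ i
    + (1 - b) * (2 * ∑ τ : T₂, quadA (m.fourth τ) (m.mass τ) γ * quadB (m.fourth τ) γ i)

/-- The equations `γ_jᵀ T̂(γ_l) = γ_lᵀ T̂(γ_j)`, antisymmetric in `(j, l)`. -/
def antiEq (b : ℝ) (m : Moments p T₁ T₂) (Γ : Fin p → Fin p → ℝ) (j l : Fin p) : ℝ :=
  Γ j ⬝ᵥ momentT b m (Γ l) - Γ l ⬝ᵥ momentT b m (Γ j)

/-- The equations `γ_jᵀ Ŝ γ_l = δ_{jl}`, symmetric in `(j, l)`. -/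
def symmEq (m : Moments p T₁ T₂) (Γ : Fin p → Fin p → ℝ) (j l : Fin p) : ℝ :=
  (Γ j ⬝ᵥ fun i => m.cov i ⬝ᵥ Γ l) - if j = l then 1 else 0

/-- The estimating equations as one square system: an antisymmetric and a symmetric matrix both
vanish if and only if their sum does. -/
def momentEq (b : ℝ) (u : Moments p T₁ T₂ × (Fin p → Fin p → ℝ)) (j l : Fin p) : ℝ :=
  antiEq b u.1 u.2 j l + symmEq u.1 u.2 j l

theorem antiEq_swap (b : ℝ) (m : Moments p T₁ T₂) (Γ : Fin p → Fin p → ℝ) (j l : Fin p) :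
    antiEq b m Γ l j = -antiEq b m Γ j l :=
  (neg_sub _ _).symm

theorem symmEq_swap {m : Moments p T₁ T₂} (hm : ∀ i k, m.cov i k = m.cov k i)
    (Γ : Fin p → Fin p → ℝ) (j l : Fin p) : symmEq m Γ l j = symmEq m Γ j l := by
  simp only [symmEq, eq_comm (a := l), dotProduct, Finset.mul_sum]
  rw [Finset.sum_comm]
  simp only [hm, mul_comm, mul_left_comm]

theorem momentEq_eq_zero_iff {b : ℝ} {m : Moments p T₁ T₂} (hm : ∀ i k, m.cov i k = m.cov k i)
    (Γ : Fin p → Fin p → ℝ) :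
    momentEq b (m, Γ) = 0 ↔ (∀ j l, antiEq b m Γ j l = 0) ∧ ∀ j l, symmEq m Γ j l = 0 := by
  constructor
  · intro h
    have hjl (j l : Fin p) : antiEq b m Γ j l + symmEq m Γ j l = 0 := congrFun₂ h j l
    have hlj (j l : Fin p) : -antiEq b m Γ j l + symmEq m Γ j l = 0 := by
      rw [← antiEq_swap, ← symmEq_swap hm, hjl]
    exact ⟨fun j l => by linarith [hjl j l, hlj j l], fun j l => by linarith [hjl j l, hlj j l]⟩
  · rintro ⟨hanti, hsymm⟩
    ext j l
    rw [momentEq, hanti, hsymm, add_zero, Pi.zero_apply, Pi.zero_apply]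

theorem contDiff_momentEq {n : WithTop ℕ∞} (b : ℝ) :
    ContDiff ℝ n (momentEq (p := p) (T₁ := T₁) (T₂ := T₂) b) := by
  refine contDiff_pi.2 fun j => contDiff_pi.2 fun l => ?_
  simp only [momentEq, antiEq, symmEq, momentT, linA, linB, quadA, quadB, dotProduct]
  fun_prop

end MomentEquations

/-! ### Sample moments -/

section SampleMoments

variable {p : ℕ} {T₁ T₂ : Finset ℕ}

/-- Sample moments of `y_1, …, y_n`. -/
def sampleMoments (T₁ T₂ : Finset ℕ) (n : ℕ) (y : ℤ → Fin p → ℝ) : Moments p T₁ T₂ :=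
  (fun τ i k => lagMean n τ fun t => y t i * y (t + (τ : ℕ)) k,
    fun τ i k u v => lagMean n τ fun t => y t i * y t k * (y (t + (τ : ℕ)) u * y (t + (τ : ℕ)) v),
    fun τ => lagMean n τ fun _ => 1,
    sampleCov n y)

theorem sampleCov_comm (n : ℕ) (y : ℤ → Fin p → ℝ) (i k : Fin p) :
    sampleCov n y i k = sampleCov n y k i := by
  simp only [sampleCov, Matrix.of_apply, mul_comm]

theorem lagMean_dotProduct (n τ : ℕ) (γ : Fin p → ℝ) (f : ℤ → Fin p → ℝ) :
    lagMean n τ (fun t => γ ⬝ᵥ f t) = γ ⬝ᵥ fun i => lagMean n τ fun t => f t i := by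
  simp only [lagMean, dotProduct, Finset.mul_sum, mul_left_comm]
  exact Finset.sum_comm

theorem lagMean_add (n τ : ℕ) (f g : ℤ → ℝ) :
    lagMean n τ (fun t => f t + g t) = lagMean n τ f + lagMean n τ g := by
  simp only [lagMean, Finset.sum_add_distrib, mul_add]

theorem lagMean_sub (n τ : ℕ) (f g : ℤ → ℝ) :
    lagMean n τ (fun t => f t - g t) = lagMean n τ f - lagMean n τ g := by
  simp only [lagMean, Finset.sum_sub_distrib, mul_sub]

theorem lagMean_congr {n τ : ℕ} {f g : ℤ → ℝ} (h : ∀ t : ℤ, 1 ≤ t → t + τ ≤ n → f t = g t) :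
    lagMean n τ f = lagMean n τ g := by
  refine congrArg ((n : ℝ)⁻¹ * ·) (Finset.sum_congr rfl fun t ht => ?_)
  rw [Finset.mem_Icc] at ht
  exact h t (by omega) (by omega)

theorem dotProduct_mul (γ v : Fin p → ℝ) (c : ℝ) : (γ ⬝ᵥ v) * c = γ ⬝ᵥ fun i => v i * c := by
  simp only [dotProduct, Finset.sum_mul, mul_assoc]

theorem mul_dotProduct (γ v : Fin p → ℝ) (c : ℝ) : c * (γ ⬝ᵥ v) = γ ⬝ᵥ fun i => c * v i := by
  simp only [dotProduct, Finset.mul_sum, mul_left_comm]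

variable (n τ : ℕ) (y : ℤ → Fin p → ℝ) (γ : Fin p → ℝ)

theorem lagMean_eq_linA :
    lagMean n τ (fun t => (γ ⬝ᵥ y t) * (γ ⬝ᵥ y (t + τ))) =
      linA (fun i k => lagMean n τ fun t => y t i * y (t + τ) k) γ := by
  simp only [linA, ← lagMean_dotProduct, ← mul_dotProduct, ← dotProduct_mul]

theorem lagMean_eq_linB (i : Fin p) :
    lagMean n τ (fun t => (γ ⬝ᵥ y (t + τ)) * y t i + (γ ⬝ᵥ y t) * y (t + τ) i) =
      linB (fun i k => lagMean n τ fun t => y t i * y (t + τ) k) γ i := by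
  simp only [linB, ← lagMean_dotProduct, ← dotProduct_mul, ← lagMean_add, mul_comm (y _ i)]

theorem lagMean_eq_quadA :
    lagMean n τ (fun t => (γ ⬝ᵥ y t) ^ 2 * (γ ⬝ᵥ y (t + τ)) ^ 2 - 1) =
      quadA (fun i k u v => lagMean n τ fun t => y t i * y t k * (y (t + τ) u * y (t + τ) v))
        (lagMean n τ fun _ => 1) γ := by
  simp only [quadA, ← lagMean_dotProduct, ← lagMean_sub, ← mul_dotProduct, ← dotProduct_mul, sq]

theorem lagMean_eq_quadB (i : Fin p) :
    lagMean n τ (fun t => (γ ⬝ᵥ y t) * (γ ⬝ᵥ y (t + τ)) ^ 2 * y t i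
        + (γ ⬝ᵥ y t) ^ 2 * (γ ⬝ᵥ y (t + τ)) * y (t + τ) i) =
      quadB (fun i k u v => lagMean n τ fun t => y t i * y t k * (y (t + τ) u * y (t + τ) v))
        γ i := by
  simp only [quadB, ← lagMean_dotProduct, ← lagMean_add, ← mul_dotProduct, ← dotProduct_mul]
  congr 1
  ext t
  ring

theorem That_eq_momentT (b : ℝ) (i : Fin p) :
    That b T₁ T₂ n y γ i = momentT b (sampleMoments T₁ T₂ n y) γ i := by
  rw [That, Ts, Tv, momentT, ← Finset.sum_coe_sort T₁, ← Finset.sum_coe_sort T₂]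
  simp only [lagMean_eq_linA, lagMean_eq_linB, lagMean_eq_quadA, lagMean_eq_quadB, sampleMoments]

theorem solvesEstEq_iff (b : ℝ) (Γ : Fin p → Fin p → ℝ) :
    SolvesEstEq b T₁ T₂ n y (Matrix.of Γ) ↔ momentEq b (sampleMoments T₁ T₂ n y, Γ) = 0 := by
  have hT (γ : Fin p → ℝ) : That b T₁ T₂ n y γ = momentT b (sampleMoments T₁ T₂ n y) γ :=
    funext fun i => That_eq_momentT n y γ b i
  rw [momentEq_eq_zero_iff (sampleCov_comm n y)]
  simp only [SolvesEstEq, hT, antiEq, symmEq, sub_eq_zero]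
  rfl

variable {n y}

theorem sampleMoments_congr {y' : ℤ → Fin p → ℝ} (h : ∀ t : ℤ, 1 ≤ t → t ≤ n → y t = y' t) :
    sampleMoments T₁ T₂ n y = sampleMoments T₁ T₂ n y' := by
  have hlag {τ : ℕ} {f : (Fin p → ℝ) → (Fin p → ℝ) → ℝ} :
      lagMean n τ (fun t => f (y t) (y (t + τ))) = lagMean n τ fun t => f (y' t) (y' (t + τ)) :=
    lagMean_congr fun t h₁ h₂ => by rw [h t h₁ (by omega), h (t + τ) (by omega) h₂]
  have hmean : sampleMean n y = sampleMean n y' := funext fun j => hlag (f := fun a _ => a j)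
  have hcov : sampleCov n y = sampleCov n y' := by
    rw [sampleCov, sampleCov, hmean]
    ext j l
    exact hlag (f := fun a _ => (a j - sampleMean n y' j) * (a l - sampleMean n y' l))
  refine Prod.ext ?_ (Prod.ext ?_ (Prod.ext rfl hcov))
  · ext τ i k
    exact hlag (f := fun a c => a i * c k)
  · ext τ i k u v
    exact hlag (f := fun a c => a i * a k * (c u * c v))

variable {α : Type*} [MeasurableSpace α]

theorem measurable_lagMean {f : α → ℤ → ℝ} (hf : ∀ t, Measurable fun a => f a t) :
    Measurable fun a => lagMean n τ (f a) :=
  (Finset.measurable_fun_sum (f := fun (t : ℕ) a => f a t) _ fun t _ => hf t).const_mul _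

theorem measurable_sampleMoments {y : α → ℤ → Fin p → ℝ} (hy : ∀ t i, Measurable fun a => y a t i) :
    Measurable fun a => sampleMoments T₁ T₂ n (y a) := by
  have hmean (j : Fin p) : Measurable fun a => sampleMean n (y a) j :=
    measurable_lagMean 0 fun t => hy t j
  have hcov : Measurable (β := Fin p → Fin p → ℝ) fun a => sampleCov n (y a) :=
    measurable_pi_iff.2 fun j => measurable_pi_iff.2 fun l =>
      measurable_lagMean 0 fun t => ((hy t j).sub (hmean j)).mul ((hy t l).sub (hmean l))
  refine .prodMk ?_ (.prodMk ?_ (.prodMk measurable_const hcov)) <;>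
    simp only [measurable_pi_iff] <;> intros <;> exact measurable_lagMean _ fun t => by fun_prop

end SampleMoments

/-! ### The estimating equations at the population moments -/

section PopulationModel

/-- Lagged second moments of a process with independent centred components, in terms of the linear
autocorrelations `μ` of the components. -/
def modelSecond {p : ℕ} (μ : Fin p → ℝ) (i k : Fin p) : ℝ :=
  if i = k then μ i else 0

/-- Lagged fourth moments of a process with independent standardized components, in terms of the
linear and quadratic autocorrelations `μ` and `ν` of the components. The first two terms are the
Gaussian ones, and `ν i - 2 * μ i ^ 2` is a fourth cumulant. -/
def modelFourth {p : ℕ} (μ ν : Fin p → ℝ) (i k u v : Fin p) : ℝ :=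
  (if i = k then 1 else 0) * (if u = v then 1 else 0)
    + μ i * μ k * ((if i = u then 1 else 0) * (if k = v then 1 else 0)
      + (if i = v then 1 else 0) * (if k = u then 1 else 0))
    + (if i = k then 1 else 0) * (if i = u then 1 else 0) * (if i = v then 1 else 0)
      * (ν i - 2 * μ i ^ 2)

/-- The identity matrix, as a family of rows. -/
abbrev idRows (p : ℕ) : Fin p → Fin p → ℝ := fun i => Pi.single i 1

/-- Moments of a process with independent standardized components. -/
def modelMoments {p : ℕ} (T₁ T₂ : Finset ℕ) (μ ν : ℕ → Fin p → ℝ) : Moments p T₁ T₂ :=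
  (fun τ => modelSecond (μ τ), fun τ => modelFourth (μ τ) (ν τ), fun _ => 1, idRows p)

/-- The factor of `γ_i` in `T(γ)_i`, where `T` is the population version of `T̂`. -/
def gain {p : ℕ} (b : ℝ) (T₁ T₂ : Finset ℕ) (μ ν : ℕ → Fin p → ℝ) (γ : Fin p → ℝ) (i : Fin p) :
    ℝ :=
  2 * b * ∑ τ ∈ T₁, linA (modelSecond (μ τ)) γ * μ τ i
    + 4 * (1 - b) * ∑ τ ∈ T₂, quadA (modelFourth (μ τ) (ν τ)) 1 γ
        * (γ ⬝ᵥ γ + 2 * μ τ i * linA (modelSecond (μ τ)) γ + (ν τ i - 2 * μ τ i ^ 2) * γ i ^ 2)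

variable {p : ℕ} {T₁ T₂ : Finset ℕ} {μ ν : ℕ → Fin p → ℝ} {b : ℝ}

theorem linA_modelSecond (μ γ : Fin p → ℝ) : linA (modelSecond μ) γ = γ ⬝ᵥ fun k => γ k * μ k := by
  simp [linA, modelSecond, dotProduct]

theorem linB_modelSecond (μ γ : Fin p → ℝ) (i : Fin p) :
    linB (modelSecond μ) γ i = γ i * (2 * μ i) := by
  simp only [linB, modelSecond, dotProduct, mul_ite, mul_zero, Finset.sum_ite_eq,
    Finset.sum_ite_eq', Finset.mem_univ, if_true]
  ring

theorem dotProduct_dotProduct_modelFourth_right (μ ν γ : Fin p → ℝ) (i k : Fin p) :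
    (γ ⬝ᵥ fun u => γ ⬝ᵥ fun v => modelFourth μ ν i k u v) =
      (if i = k then γ ⬝ᵥ γ + (ν i - 2 * μ i ^ 2) * γ i ^ 2 else 0)
        + γ k * μ k * (2 * (γ i * μ i)) := by
  simp only [modelFourth, dotProduct, mul_add, Finset.sum_add_distrib, mul_ite, ite_mul, mul_one,
    one_mul, mul_zero, zero_mul, Finset.sum_ite_irrel, Finset.sum_ite_eq, Finset.mem_univ,
    if_true, Finset.sum_const_zero]
  split_ifs <;> ring

theorem modelFourth_swap (μ ν : Fin p → ℝ) (i k u v : Fin p) :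
    modelFourth μ ν u v i k = modelFourth μ ν i k u v := by
  unfold modelFourth
  grind

theorem quadB_modelFourth (μ ν γ : Fin p → ℝ) (i : Fin p) :
    quadB (modelFourth μ ν) γ i = γ i * (2 *
      (γ ⬝ᵥ γ + 2 * μ i * linA (modelSecond μ) γ + (ν i - 2 * μ i ^ 2) * γ i ^ 2)) := by
  have hhalf : (γ ⬝ᵥ fun k => γ ⬝ᵥ fun u => γ ⬝ᵥ fun v => modelFourth μ ν i k u v) =
      γ i * (γ ⬝ᵥ γ + 2 * μ i * linA (modelSecond μ) γ + (ν i - 2 * μ i ^ 2) * γ i ^ 2) := by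
    rw [linA_modelSecond]
    simp only [dotProduct_dotProduct_modelFourth_right]
    simp only [dotProduct, mul_add, Finset.sum_add_distrib, mul_ite, mul_zero, Finset.sum_ite_eq,
      Finset.mem_univ, if_true, ← mul_assoc, ← Finset.sum_mul]
    ring
  simp only [quadB, modelFourth_swap, hhalf]
  ring

theorem momentT_modelMoments (γ : Fin p → ℝ) (i : Fin p) :
    momentT b (modelMoments T₁ T₂ μ ν) γ i = γ i * gain b T₁ T₂ μ ν γ i := by
  simp only [momentT, modelMoments, Moments.second, Moments.fourth, Moments.mass, gain,
    linB_modelSecond, quadB_modelFourth]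
  rw [← Finset.sum_coe_sort T₁, ← Finset.sum_coe_sort T₂]
  simp only [Finset.mul_sum, mul_add (γ i)]
  congr 1 <;> exact Finset.sum_congr rfl fun τ _ => by ring

theorem linA_single (M : Fin p → Fin p → ℝ) (l : Fin p) : linA M (Pi.single l 1) = M l l := by
  simp only [linA, single_dotProduct, one_mul]

theorem quadA_single (Q : Fin p → Fin p → Fin p → Fin p → ℝ) (c : ℝ) (l : Fin p) :
    quadA Q c (Pi.single l 1) = Q l l l l - c := by
  simp only [quadA, single_dotProduct, one_mul]

theorem gain_single (l i : Fin p) :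
    gain b T₁ T₂ μ ν (Pi.single l 1) i = 2 * b * ∑ τ ∈ T₁, μ τ l * μ τ i
      + 4 * (1 - b) * ∑ τ ∈ T₂, ν τ l *
        if i = l then ν τ l + 1 else 1 + 2 * μ τ i * μ τ l := by
  simp only [gain, linA_single, quadA_single, modelSecond, modelFourth, if_true, single_dotProduct,
    Pi.single_apply, one_mul, mul_one]
  congr 2
  refine Finset.sum_congr rfl fun τ _ => ?_
  split_ifs with hil
  · rw [hil]
    ring
  · ring

theorem gain_single_sub_gain_single {j l : Fin p} (hjl : j ≠ l) :
    gain b T₁ T₂ μ ν (Pi.single l 1) j - gain b T₁ T₂ μ ν (Pi.single j 1) j =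
      covCoeff b T₁ T₂ μ ν j l := by
  simp only [gain_single, if_true, if_neg hjl]
  rw [covCoeff, add_sub_add_comm, ← mul_sub, ← mul_sub, ← Finset.sum_sub_distrib,
    ← Finset.sum_sub_distrib]
  congr 2 <;> exact Finset.sum_congr rfl fun τ _ => by ring

theorem denom_eq_neg_covCoeff_sub (b : ℝ) (T₁ T₂ : Finset ℕ) (μ ν : ℕ → Fin p → ℝ)
    (j l : Fin p) :
    denom b T₁ T₂ μ ν j l = -covCoeff b T₁ T₂ μ ν j l - covCoeff b T₁ T₂ μ ν l j := by
  simp only [denom, covCoeff, Finset.mul_sum]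
  rw [neg_add, add_sub_add_comm, ← Finset.sum_neg_distrib, ← Finset.sum_neg_distrib,
    ← Finset.sum_sub_distrib, ← Finset.sum_sub_distrib]
  congr 1 <;> exact Finset.sum_congr rfl fun τ _ => by ring

theorem antiEq_modelMoments (Γ : Fin p → Fin p → ℝ) (j l : Fin p) :
    antiEq b (modelMoments T₁ T₂ μ ν) Γ j l =
      ∑ i, Γ j i * Γ l i * (gain b T₁ T₂ μ ν (Γ l) i - gain b T₁ T₂ μ ν (Γ j) i) := by
  simp only [antiEq, dotProduct, momentT_modelMoments, ← Finset.sum_sub_distrib]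
  exact Finset.sum_congr rfl fun i _ => by ring

theorem symmEq_modelMoments (Γ : Fin p → Fin p → ℝ) (j l : Fin p) :
    symmEq (modelMoments T₁ T₂ μ ν) Γ j l = Γ j ⬝ᵥ Γ l - if j = l then 1 else 0 := by
  simp only [symmEq, Moments.cov, modelMoments, single_dotProduct, one_mul]

theorem hasDerivAt_add_smul_apply (γ δ : Fin p → ℝ) (i : Fin p) :
    HasDerivAt (fun s : ℝ => (γ + s • δ) i) (δ i) 0 := by
  simpa using ((hasDerivAt_id' (0 : ℝ)).mul_const (δ i)).const_add (γ i)

theorem hasDerivAt_mul_of_eq_zero {f g : ℝ → ℝ} {f' x : ℝ} (hf : HasDerivAt f f' x)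
    (hg : DifferentiableAt ℝ g x) (h₀ : f x = 0) :
    HasDerivAt (fun s => f s * g s) (f' * g x) x := by
  simpa [h₀] using hf.fun_mul hg.hasDerivAt

theorem differentiable_gain (i : Fin p) :
    Differentiable ℝ fun γ => gain b T₁ T₂ μ ν γ i := by
  simp only [gain, linA, quadA, dotProduct]
  fun_prop

theorem hasDerivAt_antiEq_modelMoments (Δ : Fin p → Fin p → ℝ) (j l : Fin p) :
    HasDerivAt (fun s : ℝ => antiEq b (modelMoments T₁ T₂ μ ν) (idRows p + s • Δ) j l)
      (covCoeff b T₁ T₂ μ ν j l * Δ l j - covCoeff b T₁ T₂ μ ν l j * Δ j l) 0 := by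
  rcases eq_or_ne j l with rfl | hjl
  · simpa only [antiEq, sub_self] using hasDerivAt_const (0 : ℝ) (0 : ℝ)
  simp only [antiEq_modelMoments]
  have hgain (k i : Fin p) : DifferentiableAt ℝ
      (fun s : ℝ => gain b T₁ T₂ μ ν ((idRows p + s • Δ) k) i) 0 :=
    (differentiable_gain i).differentiableAt.comp (0 : ℝ)
      (f := fun s : ℝ => (idRows p + s • Δ) k) (by fun_prop)
  have hterm (i : Fin p) := hasDerivAt_mul_of_eq_zero
    ((hasDerivAt_add_smul_apply (idRows p j) (Δ j) i).fun_mul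
      (hasDerivAt_add_smul_apply (idRows p l) (Δ l) i)) ((hgain l i).fun_sub (hgain j i))
    (by simp only [zero_smul, add_zero, Pi.single_apply]; grind)
  refine (HasDerivAt.fun_sum fun i (_ : i ∈ Finset.univ) => hterm i).congr_deriv ?_
  simp only [zero_smul, add_zero, Pi.single_apply, add_mul, mul_ite, ite_mul, mul_one, one_mul,
    mul_zero, zero_mul, Finset.sum_add_distrib, Finset.sum_ite_eq', Finset.mem_univ, if_true]
  rw [← gain_single_sub_gain_single hjl, ← gain_single_sub_gain_single hjl.symm]
  ring

theorem hasDerivAt_symmEq_modelMoments (Δ : Fin p → Fin p → ℝ) (j l : Fin p) :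
    HasDerivAt (fun s : ℝ => symmEq (modelMoments T₁ T₂ μ ν) (idRows p + s • Δ) j l)
      (Δ j l + Δ l j) 0 := by
  simp only [symmEq_modelMoments, dotProduct]
  have hterm (i : Fin p) := (hasDerivAt_add_smul_apply (idRows p j) (Δ j) i).fun_mul
    (hasDerivAt_add_smul_apply (idRows p l) (Δ l) i)
  refine ((HasDerivAt.fun_sum fun i (_ : i ∈ Finset.univ) => hterm i).sub_const _).congr_deriv ?_
  simp [Finset.sum_add_distrib, Pi.single_apply]

theorem momentEq_modelMoments_idRows :
    momentEq b (modelMoments T₁ T₂ μ ν, idRows p) = 0 := by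
  ext j l
  rcases eq_or_ne j l with rfl | hjl
  · simp [momentEq, antiEq, symmEq_modelMoments]
  · simp [momentEq, antiEq_modelMoments, symmEq_modelMoments, hjl, hjl.symm, Pi.single_apply]

/-- The partial derivative of the estimating equations with respect to the matrix, at the
population moments and the identity matrix. -/
def linearization {p : ℕ} (b : ℝ) (T₁ T₂ : Finset ℕ) (μ ν : ℕ → Fin p → ℝ) :
    (Fin p → Fin p → ℝ) →L[ℝ] (Fin p → Fin p → ℝ) :=
  fderiv ℝ (momentEq b) (modelMoments T₁ T₂ μ ν, idRows p) ∘L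
    .inr ℝ (Moments p T₁ T₂) (Fin p → Fin p → ℝ)

theorem linearization_apply (Δ : Fin p → Fin p → ℝ) (j l : Fin p) :
    linearization b T₁ T₂ μ ν Δ j l =
      covCoeff b T₁ T₂ μ ν j l * Δ l j - covCoeff b T₁ T₂ μ ν l j * Δ j l + (Δ j l + Δ l j) := by
  have hline : HasDerivAt (fun s : ℝ => (modelMoments T₁ T₂ μ ν, idRows p + s • Δ)) (0, Δ) 0 := by
    refine (hasDerivAt_const (0 : ℝ) _).prodMk ?_
    simpa using ((hasDerivAt_id' (0 : ℝ)).smul_const Δ).const_add (idRows p)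
  have hchain := HasFDerivAt.comp_hasDerivAt_of_eq (0 : ℝ)
    ((contDiff_momentEq b).differentiable one_ne_zero _).hasFDerivAt hline
    (by rw [zero_smul, add_zero])
  exact (hasDerivAt_pi.1 (hasDerivAt_pi.1 hchain j) l).unique
    ((hasDerivAt_antiEq_modelMoments Δ j l).add (hasDerivAt_symmEq_modelMoments Δ j l))

theorem linearization_injective (hsep : ∀ j l, j ≠ l → denom b T₁ T₂ μ ν j l ≠ 0) :
    Function.Injective (linearization b T₁ T₂ μ ν) := by
  rw [injective_iff_map_eq_zero]
  intro Δ hΔ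
  have hzero (j l : Fin p) : covCoeff b T₁ T₂ μ ν j l * Δ l j - covCoeff b T₁ T₂ μ ν l j * Δ j l
      + (Δ j l + Δ l j) = 0 := by
    rw [← linearization_apply, hΔ]
    rfl
  have hskew (j l : Fin p) : Δ l j = -Δ j l := by linarith [hzero j l, hzero l j]
  ext j l
  rcases eq_or_ne j l with rfl | hjl
  · simpa using self_eq_neg.1 (hskew j j)
  · have hdenom : denom b T₁ T₂ μ ν j l * Δ j l = 0 := by
      rw [denom_eq_neg_covCoeff_sub, ← hzero j l, hskew j l]
      ring
    exact (mul_eq_zero.1 hdenom).resolve_left (hsep j l hjl)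

theorem linearization_isInvertible (hsep : ∀ j l, j ≠ l → denom b T₁ T₂ μ ν j l ≠ 0) :
    (linearization b T₁ T₂ μ ν).IsInvertible :=
  ⟨(LinearEquiv.ofInjectiveEndo (linearization b T₁ T₂ μ ν : (Fin p → Fin p → ℝ) →ₗ[ℝ] _)
    (linearization_injective hsep)).toContinuousLinearEquiv, rfl⟩

end PopulationModel

/-! ### Convergence of the sample moments -/

section ProcessMoments

variable {Ω : Type*} [MeasurableSpace Ω] {P : Measure Ω} {p : ℕ} {x : ℤ → Ω → Fin p → ℝ}

theorem measurable_component (hmeas : ∀ t, Measurable (x t)) (j : Fin p) :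
    Measurable fun (ω : Ω) (t : ℤ) => x t ω j :=
  measurable_pi_lambda _ fun t => (measurable_pi_apply j).comp (hmeas t)

theorem integral_mul_eq_zero_of_ne (hmeas : ∀ t, Measurable (x t))
    (hindep : iIndepFun (fun (j : Fin p) (ω : Ω) (t : ℤ) => x t ω j) P)
    (hmean : ∀ t j, ∫ ω, x t ω j ∂P = 0) {i k : Fin p} (hik : i ≠ k) (s t : ℤ) :
    ∫ ω, x s ω i * x t ω k ∂P = 0 := by
  have hst : IndepFun (fun ω => x s ω i) (fun ω => x t ω k) P :=
    (hindep.indepFun hik).comp (measurable_pi_apply s) (measurable_pi_apply t)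
  rw [hst.integral_fun_mul_eq_mul_integral, hmean, zero_mul]
  all_goals exact ((measurable_pi_apply _).comp (hmeas _)).aestronglyMeasurable

theorem integral_mul_mul_mul_of_ne (hmeas : ∀ t, Measurable (x t))
    (hindep : iIndepFun (fun (j : Fin p) (ω : Ω) (t : ℤ) => x t ω j) P) {i k : Fin p} (hik : i ≠ k)
    (s₁ s₂ t₁ t₂ : ℤ) :
    ∫ ω, x s₁ ω i * x s₂ ω i * (x t₁ ω k * x t₂ ω k) ∂P =
      (∫ ω, x s₁ ω i * x s₂ ω i ∂P) * ∫ ω, x t₁ ω k * x t₂ ω k ∂P := by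
  have hst : IndepFun (fun ω => x s₁ ω i * x s₂ ω i) (fun ω => x t₁ ω k * x t₂ ω k) P :=
    (hindep.indepFun hik).comp (φ := fun y : ℤ → ℝ => y s₁ * y s₂)
      (ψ := fun y : ℤ → ℝ => y t₁ * y t₂) (by fun_prop) (by fun_prop)
  exact hst.integral_fun_mul_eq_mul_integral (by fun_prop) (by fun_prop)

theorem integral_mul_mul_mul_eq_zero_of_forall_ne (hmeas : ∀ t, Measurable (x t))
    (hindep : iIndepFun (fun (j : Fin p) (ω : Ω) (t : ℤ) => x t ω j) P)
    (hmean : ∀ t j, ∫ ω, x t ω j ∂P = 0) {i k u v : Fin p} (hik : i ≠ k) (hiu : i ≠ u) (hiv : i ≠ v)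
    (t₁ t₂ t₃ t₄ : ℤ) : ∫ ω, x t₁ ω i * (x t₂ ω k * (x t₃ ω u * x t₄ ω v)) ∂P = 0 := by
  have hdisj : Disjoint {i} ({k, u, v} : Finset (Fin p)) := by simp [hik, hiu, hiv]
  have hprod : IndepFun (fun ω => x t₁ ω i) (fun ω => x t₂ ω k * (x t₃ ω u * x t₄ ω v)) P :=
    (hindep.indepFun_finset _ _ hdisj (measurable_component hmeas)).comp
      (φ := fun y : ({i} : Finset (Fin p)) → ℤ → ℝ => y ⟨i, by simp⟩ t₁)
      (ψ := fun y : ({k, u, v} : Finset (Fin p)) → ℤ → ℝ =>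
        y ⟨k, by simp⟩ t₂ * (y ⟨u, by simp⟩ t₃ * y ⟨v, by simp⟩ t₄))
      (by fun_prop) (by fun_prop)
  rw [hprod.integral_fun_mul_eq_mul_integral (by fun_prop) (by fun_prop), hmean, zero_mul]

theorem integral_eq_modelSecond (hmeas : ∀ t, Measurable (x t))
    (hindep : iIndepFun (fun (j : Fin p) (ω : Ω) (t : ℤ) => x t ω j) P)
    (hmean : ∀ t j, ∫ ω, x t ω j ∂P = 0) (τ : ℕ) (i k : Fin p) :
    ∫ ω, x 0 ω i * x τ ω k ∂P = modelSecond (linCorr P x τ) i k := by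
  rw [modelSecond]
  split_ifs with hik
  · rw [hik, linCorr]
  · exact integral_mul_eq_zero_of_ne hmeas hindep hmean hik 0 τ

theorem integral_eq_modelFourth_self (hmeas : ∀ t, Measurable (x t))
    (hindep : iIndepFun (fun (j : Fin p) (ω : Ω) (t : ℤ) => x t ω j) P)
    (hmean : ∀ t j, ∫ ω, x t ω j ∂P = 0) (hvar : ∀ t j, ∫ ω, x t ω j * x t ω j ∂P = 1) (τ : ℕ)
    (i u v : Fin p) :
    ∫ ω, x 0 ω i * x 0 ω i * (x τ ω u * x τ ω v) ∂P =
      modelFourth (linCorr P x τ) (quadCorr P x τ) i i u v := by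
  rcases eq_or_ne u v with rfl | huv
  · rcases eq_or_ne i u with rfl | hiu
    · have hquad : ∫ ω, x 0 ω i * x 0 ω i * (x τ ω i * x τ ω i) ∂P = quadCorr P x τ i + 1 := by
        simp only [quadCorr, sub_add_cancel, sq]
      simp only [hquad, modelFourth, if_true]
      ring
    · simp [integral_mul_mul_mul_of_ne hmeas hindep hiu, hvar, modelFourth, hiu]
  · have hzero : modelFourth (linCorr P x τ) (quadCorr P x τ) i i u v = 0 := by
      unfold modelFourth
      grind
    rw [hzero]
    rcases ne_or_eq u i with hui | rfl
    · simpa only [mul_comm, mul_left_comm, mul_assoc] using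
        integral_mul_mul_mul_eq_zero_of_forall_ne hmeas hindep hmean hui hui huv τ 0 0 τ
    · simpa only [mul_comm, mul_left_comm, mul_assoc] using
        integral_mul_mul_mul_eq_zero_of_forall_ne hmeas hindep hmean huv.symm huv.symm huv.symm
          τ 0 0 τ

theorem integral_eq_modelFourth (hmeas : ∀ t, Measurable (x t))
    (hindep : iIndepFun (fun (j : Fin p) (ω : Ω) (t : ℤ) => x t ω j) P)
    (hmean : ∀ t j, ∫ ω, x t ω j ∂P = 0) (hvar : ∀ t j, ∫ ω, x t ω j * x t ω j ∂P = 1) (τ : ℕ)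
    (i k u v : Fin p) :
    ∫ ω, x 0 ω i * x 0 ω k * (x τ ω u * x τ ω v) ∂P =
      modelFourth (linCorr P x τ) (quadCorr P x τ) i k u v := by
  rcases eq_or_ne i k with rfl | hik
  · exact integral_eq_modelFourth_self hmeas hindep hmean hvar τ i u v
  have hmodel : modelFourth (linCorr P x τ) (quadCorr P x τ) i k u v =
      if i = u ∧ k = v ∨ i = v ∧ k = u then linCorr P x τ i * linCorr P x τ k else 0 := by
    unfold modelFourth
    grind
  rw [hmodel]
  split_ifs with hcross
  · simp only [linCorr, ← integral_mul_mul_mul_of_ne hmeas hindep hik]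
    rcases hcross with ⟨rfl, rfl⟩ | ⟨rfl, rfl⟩ <;>
      exact integral_congr_ae (.of_forall fun ω => by ring)
  · have hisol : (i ≠ u ∧ i ≠ v) ∨ (k ≠ u ∧ k ≠ v) := by grind
    rcases hisol with ⟨hiu, hiv⟩ | ⟨hku, hkv⟩
    · simpa only [mul_assoc] using
        integral_mul_mul_mul_eq_zero_of_forall_ne hmeas hindep hmean hik hiu hiv 0 0 τ τ
    · simpa only [mul_left_comm, mul_assoc] using
        integral_mul_mul_mul_eq_zero_of_forall_ne hmeas hindep hmean hik.symm hku hkv 0 0 τ τ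

theorem memLp_two_mul (hmom : ∀ t j, MemLp (fun ω => x t ω j) 4 P) (s t : ℤ) (i k : Fin p) :
    MemLp (fun ω => x s ω i * x t ω k) 2 P := by
  have : ENNReal.HolderTriple 4 4 2 := by
    refine ⟨?_⟩
    rw [← two_mul, show (4 : ℝ≥0∞) = 2 * 2 by norm_num, ENNReal.mul_inv (by simp) (by simp),
      ← mul_assoc, ENNReal.mul_inv_cancel (by simp) (by simp), one_mul]
  exact (hmom t k).mul' (hmom s i)

theorem sampleCov_eq_sub {n : ℕ} (hn : n ≠ 0) (y : ℤ → Fin p → ℝ) (i k : Fin p) :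
    sampleCov n y i k = lagMean n 0 (fun t => y t i * y t k) -
      lagMean n 0 (fun t => y t i) * lagMean n 0 (fun t => y t k) := by
  have hn' : (n : ℝ) ≠ 0 := Nat.cast_ne_zero.2 hn
  have hsum (j : Fin p) : ∑ t ∈ Finset.Icc 1 n, y t j = n * sampleMean n y j := by
    rw [sampleMean, lagMean, Nat.sub_zero, mul_inv_cancel_left₀ hn']
  change _ = _ - sampleMean n y i * sampleMean n y k
  simp only [sampleCov, Matrix.of_apply, lagMean, sub_mul, mul_sub, Finset.sum_sub_distrib,
    ← Finset.mul_sum, ← Finset.sum_mul, hsum, Finset.sum_const, Nat.card_Icc, nsmul_eq_mul,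
    Nat.sub_zero, Nat.add_sub_cancel]
  field_simp
  ring

theorem tendsto_sampleCov [IsProbabilityMeasure P] (hmeas : ∀ t, Measurable (x t))
    (herg : Ergodic (fun (y : ℤ → Fin p → ℝ) (t : ℤ) => y (t + 1))
      (P.map fun ω (t : ℤ) => x t ω))
    (hmom : ∀ t j, MemLp (fun ω => x t ω j) 2 P) (i k : Fin p) :
    Tendsto (fun z : ℕ × Ω => sampleCov z.1 (fun t => x t z.2) i k) (probFilter P)
      (𝓝 (∫ ω, x 0 ω i * x 0 ω k ∂P - (∫ ω, x 0 ω i ∂P) * ∫ ω, x 0 ω k ∂P)) := by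
  have hmean (j : Fin p) := tendsto_lagMean hmeas herg 0 (g := fun y => y 0 j) (by fun_prop)
    ((hmom 0 j).integrable one_le_two)
  have hprod := tendsto_lagMean hmeas herg 0 (g := fun y => y 0 i * y 0 k) (by fun_prop)
    ((hmom 0 i).integrable_mul (hmom 0 k))
  simp only [zero_add] at hmean hprod
  refine (hprod.sub ((hmean i).mul (hmean k))).congr' ?_
  filter_upwards [(tendsto_fst_probFilter (P := P)).eventually_ne_atTop 0] with z hz
  exact (sampleCov_eq_sub hz (fun t => x t z.2) i k).symm

theorem tendsto_sampleMoments [IsProbabilityMeasure P] (hmeas : ∀ t, Measurable (x t))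
    (herg : Ergodic (fun (y : ℤ → Fin p → ℝ) (t : ℤ) => y (t + 1))
      (P.map fun ω (t : ℤ) => x t ω))
    (hmom : ∀ t j, MemLp (fun ω => x t ω j) 4 P)
    (hmean : ∀ t j, ∫ ω, x t ω j ∂P = 0)
    (hcov : ∀ t j l, ∫ ω, x t ω j * x t ω l ∂P = if j = l then 1 else 0)
    (hindep : iIndepFun (fun (j : Fin p) (ω : Ω) (t : ℤ) => x t ω j) P) (T₁ T₂ : Finset ℕ) :
    Tendsto (fun z : ℕ × Ω => sampleMoments T₁ T₂ z.1 fun t => x t z.2) (probFilter P)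
      (𝓝 (modelMoments T₁ T₂ (linCorr P x) (quadCorr P x))) := by
  refine .prodMk_nhds ?_ (.prodMk_nhds ?_ (.prodMk_nhds ?_ ?_))
  · refine tendsto_pi_nhds.2 fun τ => tendsto_pi_nhds.2 fun i => tendsto_pi_nhds.2 fun k => ?_
    have hlag := tendsto_lagMean hmeas herg τ (g := fun y => y 0 i * y (τ : ℕ) k) (by fun_prop)
      ((memLp_two_mul hmom 0 τ i k).integrable one_le_two)
    rw [integral_eq_modelSecond hmeas hindep hmean] at hlag
    simpa only [zero_add, add_comm ((τ : ℕ) : ℤ)] using hlag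
  · refine tendsto_pi_nhds.2 fun τ => tendsto_pi_nhds.2 fun i => tendsto_pi_nhds.2 fun k =>
      tendsto_pi_nhds.2 fun u => tendsto_pi_nhds.2 fun v => ?_
    have hlag := tendsto_lagMean hmeas herg τ
      (g := fun y => y 0 i * y 0 k * (y (τ : ℕ) u * y (τ : ℕ) v)) (by fun_prop)
      ((memLp_two_mul hmom 0 0 i k).integrable_mul (memLp_two_mul hmom τ τ u v))
    rw [integral_eq_modelFourth hmeas hindep hmean fun t j => by rw [hcov, if_pos rfl]] at hlag
    simpa only [zero_add, add_comm ((τ : ℕ) : ℤ)] using hlag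
  · refine tendsto_pi_nhds.2 fun τ => ?_
    have hlag := tendsto_lagMean hmeas herg τ (g := fun _ => 1) (by fun_prop) (integrable_const _)
    rwa [integral_const, probReal_univ, one_smul] at hlag
  · refine tendsto_pi_nhds.2 fun i => tendsto_pi_nhds.2 fun k => ?_
    have hlag := tendsto_sampleCov hmeas herg
      (fun t j => (hmom t j).mono_exponent (by norm_num)) i k
    simpa only [hcov, hmean, mul_zero, sub_zero, Pi.single_apply, eq_comm (a := k)] using hlag

end ProcessMoments

/-! ### The estimator -/

section Estimator

variable {p : ℕ} {T₁ T₂ : Finset ℕ} {b r : ℝ}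

/-- The observations `x_1, …, x_n` as a series on `ℤ`, extended by zero. -/
def extendSeries (n : ℕ) (d : Fin n → Fin p → ℝ) (t : ℤ) : Fin p → ℝ :=
  if h : 1 ≤ t ∧ t ≤ n then d ⟨(t - 1).toNat, by omega⟩ else 0

theorem measurable_extendSeries (n : ℕ) (t : ℤ) (i : Fin p) :
    Measurable fun d : Fin n → Fin p → ℝ => extendSeries n d t i := by
  unfold extendSeries
  split_ifs with h
  · fun_prop
  · exact measurable_const

theorem sampleMoments_extendSeries (n : ℕ) (y : ℤ → Fin p → ℝ) :
    sampleMoments T₁ T₂ n (extendSeries n fun k => y (((k : ℕ) : ℤ) + 1)) =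
      sampleMoments T₁ T₂ n y := by
  refine sampleMoments_congr fun t h₁ h₂ => ?_
  rw [extendSeries, dif_pos ⟨h₁, h₂⟩]
  congr 1
  change (((t - 1).toNat : ℕ) : ℤ) + 1 = t
  omega

set_option synthInstance.maxSize 1000 in
instance opensMeasurableSpace_moments : OpensMeasurableSpace (Moments p T₁ T₂) :=
  inferInstance

theorem idRows_apply (i j : Fin p) : idRows p i j = (1 : Matrix (Fin p) (Fin p) ℝ) i j := by
  simp only [Pi.single_apply, Matrix.one_apply, eq_comm (a := j)]

theorem dist_idRows_le_iff (hr : 0 ≤ r) (Γ : Fin p → Fin p → ℝ) :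
    dist Γ (idRows p) ≤ r ↔ ∀ i j, |Γ i j - (1 : Matrix (Fin p) (Fin p) ℝ) i j| ≤ r := by
  simp only [dist_pi_le_iff hr, Real.dist_eq, idRows_apply]

variable {Ω : Type*} [MeasurableSpace Ω] {P : Measure Ω} {x : ℤ → Ω → Fin p → ℝ}
  {Γ : ℕ → Ω → Fin p → Fin p → ℝ}

theorem isEstimator_iff (hr : 0 ≤ r) :
    IsEstimator P b T₁ T₂ x r (fun n ω => Matrix.of (Γ n ω)) ↔ ∀ᶠ z in probFilter P,
      momentEq b (sampleMoments T₁ T₂ z.1 fun t => x t z.2, Γ z.1 z.2) = 0 ∧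
        dist (Γ z.1 z.2) (idRows p) ≤ r := by
  simp only [eventually_probFilter, dist_idRows_le_iff hr, ← solvesEstEq_iff]
  rfl

section LocalSolution

variable {V : Set (Moments p T₁ T₂)} {φ : Moments p T₁ T₂ → Fin p → Fin p → ℝ}
  {m₀ : Moments p T₁ T₂}

theorem exists_measurable_isEstimator (hr : 0 ≤ r) (hV : IsOpen V) (hφ : ContinuousOn φ V)
    (hsol : ∀ m ∈ V, momentEq b (m, φ m) = 0 ∧ dist (φ m) (idRows p) ≤ r)
    (hmV : ∀ᶠ z in probFilter P, sampleMoments T₁ T₂ z.1 (fun t => x t z.2) ∈ V) :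
    ∃ G : (n : ℕ) → (Fin n → Fin p → ℝ) → Matrix (Fin p) (Fin p) ℝ,
      (∀ n i j, Measurable fun d => G n d i j) ∧
        IsEstimator P b T₁ T₂ x r fun n ω => G n fun k => x (((k : ℕ) : ℤ) + 1) ω := by
  classical
  refine ⟨fun n d => Matrix.of (V.piecewise φ (fun _ => idRows p)
    (sampleMoments T₁ T₂ n (extendSeries n d))), fun n i j => ?_, (isEstimator_iff hr).2 ?_⟩
  · have hpiecewise : Measurable (V.piecewise φ fun _ => idRows p) :=
      hφ.measurable_piecewise continuousOn_const hV.measurableSet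
    exact measurable_pi_iff.1 (measurable_pi_iff.1
      (hpiecewise.comp (measurable_sampleMoments (measurable_extendSeries n))) i) j
  · filter_upwards [hmV] with z hz
    rw [sampleMoments_extendSeries z.1 fun t => x t z.2, Set.piecewise_eq_of_mem _ _ _ hz]
    exact hsol _ hz

theorem tendsto_idRows_of_isEstimator (hr : 0 ≤ r) (hV : IsOpen V) (hm₀ : m₀ ∈ V)
    (hφ : ContinuousOn φ V) (h₀ : momentEq b (m₀, idRows p) = 0)
    (hsol : ∀ m ∈ V, ∀ A, momentEq b (m, A) = 0 ∧ dist A (idRows p) ≤ r ↔ A = φ m)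
    (hlim : Tendsto (fun z : ℕ × Ω => sampleMoments T₁ T₂ z.1 fun t => x t z.2) (probFilter P)
      (𝓝 m₀))
    (hΓ : IsEstimator P b T₁ T₂ x r fun n ω => Matrix.of (Γ n ω)) :
    Tendsto (fun z : ℕ × Ω => Γ z.1 z.2) (probFilter P) (𝓝 (idRows p)) := by
  have hφ₀ : idRows p = φ m₀ := (hsol m₀ hm₀ _).1 ⟨h₀, by rwa [dist_self]⟩
  rw [hφ₀]
  refine ((hφ.continuousAt (hV.mem_nhds hm₀)).tendsto.comp hlim).congr' ?_
  filter_upwards [hlim.eventually (hV.mem_nhds hm₀), (isEstimator_iff hr).1 hΓ] with z hzV hz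
  exact ((hsol _ hzV _).1 hz).symm

end LocalSolution

theorem antiEq_sampleMoments_idRows (n : ℕ) (y : ℤ → Fin p → ℝ) (j l : Fin p) :
    antiEq b (sampleMoments T₁ T₂ n y) (idRows p) j l =
      Tvec b T₁ T₂ n y l j - Tvec b T₁ T₂ n y j l := by
  simp only [antiEq, Tvec, That_eq_momentT, single_dotProduct, one_mul]

theorem symmEq_sampleMoments_idRows (n : ℕ) (y : ℤ → Fin p → ℝ) (j l : Fin p) :
    symmEq (sampleMoments T₁ T₂ n y) (idRows p) j l =
      sampleCov n y j l - if j = l then 1 else 0 := by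
  simp only [symmEq, sampleMoments, single_dotProduct, dotProduct_single, one_mul, mul_one]

theorem bddInProb_momentEq_apply
    (hS : ∀ j l, BddInProb P fun (n : ℕ) ω =>
      √(n : ℝ) * (sampleCov n (fun t => x t ω) j l - if j = l then 1 else 0))
    (hT : ∀ j l, j ≠ l → BddInProb P fun (n : ℕ) ω =>
      √(n : ℝ) * Tvec b T₁ T₂ n (fun t => x t ω) j l) (j l : Fin p) :
    BddInProb P fun n ω =>
      √(n : ℝ) * momentEq b (sampleMoments T₁ T₂ n fun t => x t ω, idRows p) j l := by
  simp only [momentEq, antiEq_sampleMoments_idRows, symmEq_sampleMoments_idRows]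
  rcases eq_or_ne j l with rfl | hjl
  · simpa only [sub_self, zero_add] using hS j j
  · have hneg : BddInProb P fun (n : ℕ) ω => -(√(n : ℝ) * Tvec b T₁ T₂ n (fun t => x t ω) j l) :=
      (hT j l hjl).mono fun n ω => (abs_neg _).le
    simpa only [mul_add, mul_sub, sub_eq_add_neg, mul_neg] using
      ((hT l j hjl.symm).add hneg).add (hS j l)

theorem bddInProb_norm_momentEq
    (hS : ∀ j l, BddInProb P fun (n : ℕ) ω =>
      √(n : ℝ) * (sampleCov n (fun t => x t ω) j l - if j = l then 1 else 0))
    (hT : ∀ j l, j ≠ l → BddInProb P fun (n : ℕ) ω =>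
      √(n : ℝ) * Tvec b T₁ T₂ n (fun t => x t ω) j l) :
    BddInProb P fun n ω =>
      ‖√(n : ℝ) • momentEq b (sampleMoments T₁ T₂ n fun t => x t ω, idRows p)‖ :=
  .norm_pi fun j => .norm_pi fun l =>
    (bddInProb_momentEq_apply hS hT j l).mono fun _ _ => (abs_abs _).le

/-- The estimating equations at `Γ`, linearized at the identity matrix: the sample moments are
kept in the constant term and replaced by the population ones in the derivative. -/
def linearizedEq (b : ℝ) (T₁ T₂ : Finset ℕ) (μ ν : ℕ → Fin p → ℝ) (n : ℕ) (y : ℤ → Fin p → ℝ)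
    (Γ : Fin p → Fin p → ℝ) : Fin p → Fin p → ℝ :=
  momentEq b (sampleMoments T₁ T₂ n y, idRows p) + linearization b T₁ T₂ μ ν (Γ - idRows p)

section LinearizedEq

variable {μ ν : ℕ → Fin p → ℝ}

theorem linearizedEq_apply_self (n : ℕ) (y : ℤ → Fin p → ℝ) (A : Fin p → Fin p → ℝ) (j : Fin p) :
    linearizedEq b T₁ T₂ μ ν n y A j j = sampleCov n y j j - 1 + 2 * (A j j - 1) := by
  simp only [linearizedEq, Pi.add_apply, Pi.sub_apply, linearization_apply, momentEq,
    antiEq_sampleMoments_idRows, symmEq_sampleMoments_idRows, if_true, Pi.single_eq_same]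
  ring

theorem linearizedEq_apply_of_ne (n : ℕ) (y : ℤ → Fin p → ℝ) (A : Fin p → Fin p → ℝ)
    {j l : Fin p} (hjl : j ≠ l) :
    linearizedEq b T₁ T₂ μ ν n y A j l =
      Tvec b T₁ T₂ n y l j - Tvec b T₁ T₂ n y j l + sampleCov n y j l
        + (covCoeff b T₁ T₂ μ ν j l * A l j - covCoeff b T₁ T₂ μ ν l j * A j l
          + (A j l + A l j)) := by
  simp only [linearizedEq, Pi.add_apply, Pi.sub_apply, linearization_apply, momentEq,
    antiEq_sampleMoments_idRows, symmEq_sampleMoments_idRows, if_neg hjl,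
    Pi.single_eq_of_ne hjl, Pi.single_eq_of_ne hjl.symm, sub_zero]

theorem linearizedEq_combination_of_ne (n : ℕ) (y : ℤ → Fin p → ℝ) (A : Fin p → Fin p → ℝ)
    {j l : Fin p} (hjl : j ≠ l) :
    (1 - covCoeff b T₁ T₂ μ ν j l) / 2 * linearizedEq b T₁ T₂ μ ν n y A j l
        - (1 + covCoeff b T₁ T₂ μ ν j l) / 2 * linearizedEq b T₁ T₂ μ ν n y A l j =
      A j l * denom b T₁ T₂ μ ν j l - (Tvec b T₁ T₂ n y j l - Tvec b T₁ T₂ n y l j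
        + covCoeff b T₁ T₂ μ ν j l * sampleCov n y j l) := by
  rw [linearizedEq_apply_of_ne n y A hjl, linearizedEq_apply_of_ne n y A hjl.symm,
    sampleCov_comm n y l j, denom_eq_neg_covCoeff_sub]
  ring

theorem tendsto_sqrt_smul_linearizedEq (hsep : ∀ j l, j ≠ l → denom b T₁ T₂ μ ν j l ≠ 0)
    (hlim : Tendsto (fun z : ℕ × Ω => sampleMoments T₁ T₂ z.1 fun t => x t z.2) (probFilter P)
      (𝓝 (modelMoments T₁ T₂ μ ν)))
    (hΓ : Tendsto (fun z : ℕ × Ω => Γ z.1 z.2) (probFilter P) (𝓝 (idRows p)))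
    (hsol : ∀ᶠ z in probFilter P,
      momentEq b (sampleMoments T₁ T₂ z.1 fun t => x t z.2, Γ z.1 z.2) = 0)
    (hbdd : BddInProb P fun n ω =>
      ‖√(n : ℝ) • momentEq b (sampleMoments T₁ T₂ n fun t => x t ω, idRows p)‖) :
    Tendsto (fun z : ℕ × Ω => √(z.1 : ℝ) •
      linearizedEq b T₁ T₂ μ ν z.1 (fun t => x t z.2) (Γ z.1 z.2)) (probFilter P) (𝓝 0) :=
  hbdd.tendsto_smul_zero_of_isLittleO (a := fun n => √(n : ℝ))
    (isLittleO_of_solution ((contDiff_momentEq b).contDiffAt.hasStrictFDerivAt one_ne_zero)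
      (linearization_isInvertible hsep) hlim hΓ hsol)

theorem tendstoInMeasure_diag_expansion
    (hlin : Tendsto (fun z : ℕ × Ω => √(z.1 : ℝ) •
      linearizedEq b T₁ T₂ μ ν z.1 (fun t => x t z.2) (Γ z.1 z.2)) (probFilter P) (𝓝 0))
    (j : Fin p) :
    TendstoInMeasure P (fun (n : ℕ) ω => √(n : ℝ) * (Γ n ω j j - 1)
      - (-(1 / 2) * (√(n : ℝ) * (sampleCov n (fun t => x t ω) j j - 1)))) atTop fun _ => 0 := by
  rw [← tendsto_probFilter_iff_tendstoInMeasure]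
  have hhalf := (tendsto_pi_nhds.1 (tendsto_pi_nhds.1 hlin j) j).const_mul (1 / 2)
  simp only [Pi.smul_apply, linearizedEq_apply_self, Pi.zero_apply, mul_zero, smul_eq_mul] at hhalf
  exact hhalf.congr fun z => by ring

theorem tendstoInMeasure_offDiag_expansion {j l : Fin p} (hjl : j ≠ l)
    (hD : denom b T₁ T₂ μ ν j l ≠ 0)
    (hlin : Tendsto (fun z : ℕ × Ω => √(z.1 : ℝ) •
      linearizedEq b T₁ T₂ μ ν z.1 (fun t => x t z.2) (Γ z.1 z.2)) (probFilter P) (𝓝 0)) :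
    TendstoInMeasure P (fun (n : ℕ) ω => √(n : ℝ) * Γ n ω j l
      - (√(n : ℝ) * Tvec b T₁ T₂ n (fun t => x t ω) j l
          - √(n : ℝ) * Tvec b T₁ T₂ n (fun t => x t ω) l j
          + covCoeff b T₁ T₂ μ ν j l * (√(n : ℝ) * sampleCov n (fun t => x t ω) j l))
        * (denom b T₁ T₂ μ ν j l)⁻¹) atTop fun _ => 0 := by
  rw [← tendsto_probFilter_iff_tendstoInMeasure]
  have hentry (i k : Fin p) := tendsto_pi_nhds.1 (tendsto_pi_nhds.1 hlin i) k
  have hcomb := (((hentry j l).const_mul ((1 - covCoeff b T₁ T₂ μ ν j l) / 2)).sub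
    ((hentry l j).const_mul ((1 + covCoeff b T₁ T₂ μ ν j l) / 2))).mul_const
      (denom b T₁ T₂ μ ν j l)⁻¹
  simp only [Pi.smul_apply, smul_eq_mul, mul_left_comm _ (√_), ← mul_sub,
    linearizedEq_combination_of_ne _ _ _ hjl, Pi.zero_apply, mul_zero, sub_zero, zero_mul] at hcomb
  refine hcomb.congr fun z => ?_
  field_simp

end LinearizedEq

end Estimator

end GSOBI

end

open GSOBI in
theorem theorem1_general {Ω : Type*} [MeasurableSpace Ω] (P : Measure Ω) [IsProbabilityMeasure P]
    {p : ℕ} (b : ℝ) (T₁ T₂ : Finset ℕ)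
    (x : ℤ → Ω → Fin p → ℝ)
    (hmeas : ∀ t, Measurable (x t))
    (herg : Ergodic (fun (y : ℤ → Fin p → ℝ) (t : ℤ) => y (t + 1))
      (P.map (fun ω (t : ℤ) => x t ω)))
    (hmom : ∀ t j, MemLp (fun ω => x t ω j) 4 P)
    (hmean : ∀ t j, ∫ ω, x t ω j ∂P = 0)
    (hcov : ∀ t j l, ∫ ω, x t ω j * x t ω l ∂P = if j = l then 1 else 0)
    (hindep : iIndepFun (fun (j : Fin p) (ω : Ω) (t : ℤ) => x t ω j) P)
    (hsep : ∀ j l, j ≠ l →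
      denom b T₁ T₂ (linCorr P x) (quadCorr P x) j l ≠ 0) :
    ∃ r : ℝ, 0 < r ∧
      (∃ G : (n : ℕ) → (Fin n → Fin p → ℝ) → Matrix (Fin p) (Fin p) ℝ,
        (∀ n i j, Measurable (fun d => G n d i j)) ∧
        IsEstimator P b T₁ T₂ x r
          (fun n ω => G n (fun k => x (((k : ℕ) : ℤ) + 1) ω))) ∧
      ∀ Γ : ℕ → Ω → Matrix (Fin p) (Fin p) ℝ, IsEstimator P b T₁ T₂ x r Γ →
        (∀ j l, TendstoInMeasure P (fun n ω => Γ n ω j l) atTop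
          (fun _ => (1 : Matrix (Fin p) (Fin p) ℝ) j l)) ∧
        ((∀ j l, BddInProb P (fun (n : ℕ) ω =>
            √(n : ℝ) * (sampleCov n (fun t => x t ω) j l - if j = l then 1 else 0))) →
          (∀ j l, j ≠ l → BddInProb P (fun (n : ℕ) ω =>
            √(n : ℝ) * Tvec b T₁ T₂ n (fun t => x t ω) j l)) →
          (∀ j, TendstoInMeasure P (fun (n : ℕ) ω =>
            √(n : ℝ) * (Γ n ω j j - 1)
              - (-(1 / 2) * (√(n : ℝ) * (sampleCov n (fun t => x t ω) j j - 1))))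
            atTop (fun _ => (0 : ℝ))) ∧
          (∀ j l, j ≠ l → TendstoInMeasure P (fun (n : ℕ) ω =>
            √(n : ℝ) * Γ n ω j l
              - (√(n : ℝ) * Tvec b T₁ T₂ n (fun t => x t ω) j l
                  - √(n : ℝ) * Tvec b T₁ T₂ n (fun t => x t ω) l j
                  + covCoeff b T₁ T₂ (linCorr P x) (quadCorr P x) j l
                    * (√(n : ℝ) * sampleCov n (fun t => x t ω) j l))
                * (denom b T₁ T₂ (linCorr P x) (quadCorr P x) j l)⁻¹)
            atTop (fun _ => (0 : ℝ)))) := by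
  have hlim := tendsto_sampleMoments hmeas herg hmom hmean hcov hindep T₁ T₂
  have h₀ := momentEq_modelMoments_idRows (b := b) (T₁ := T₁) (T₂ := T₂)
    (μ := linCorr P x) (ν := quadCorr P x)
  obtain ⟨r, hr, V, hV, hmV, φ, hφ, hsol⟩ := exists_local_solution
    (contDiff_momentEq b).contDiffAt (linearization_isInvertible hsep) h₀
  refine ⟨r, hr, exists_measurable_isEstimator hr.le hV hφ (fun m hm => (hsol m hm _).2 rfl)
    (hlim.eventually (hV.mem_nhds hmV)), fun Γ hΓ => ?_⟩
  have hΓlim := tendsto_idRows_of_isEstimator hr.le hV hmV hφ h₀ hsol hlim hΓ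
  refine ⟨fun j l => ?_, fun hS hT => ?_⟩
  · rw [← tendsto_probFilter_iff_tendstoInMeasure, ← idRows_apply]
    exact tendsto_pi_nhds.1 (tendsto_pi_nhds.1 hΓlim j) l
  have hlin := tendsto_sqrt_smul_linearizedEq hsep hlim hΓlim
    (((isEstimator_iff hr.le).1 hΓ).mono fun z hz => hz.1) (bddInProb_norm_momentEq hS hT)
  exact ⟨tendstoInMeasure_diag_expansion hlin,
    fun j l hjl => tendstoInMeasure_offDiag_expansion hjl (hsep j l hjl) hlin⟩

theorem theorem1 {Ω : Type*} [MeasurableSpace Ω] (P : Measure Ω) [IsProbabilityMeasure P]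
    {p : ℕ} (b : ℝ) (hb0 : 0 ≤ b) (hb1 : b ≤ 1) (T₁ T₂ : Finset ℕ)
    (x : ℤ → Ω → Fin p → ℝ)
    -- strictly stationary ergodic process with finite fourth moments
    (hmeas : ∀ t, Measurable (x t))
    (herg : Ergodic (fun (y : ℤ → Fin p → ℝ) (t : ℤ) => y (t + 1))
      (P.map (fun ω (t : ℤ) => x t ω)))
    (hmom : ∀ t j, MemLp (fun ω => x t ω j) 4 P)
    -- (A1): centred with identity covariance matrix
    (hmean : ∀ t j, ∫ ω, x t ω j ∂P = 0)
    (hcov : ∀ t j l, ∫ ω, x t ω j * x t ω l ∂P = if j = l then 1 else 0)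
    -- (A2): the component series are mutually independent
    (hindep : iIndepFun (fun (j : Fin p) (ω : Ω) (t : ℤ) => x t ω j) P)
    -- (A3): every pair of components is separated by the weighted autocorrelations
    (hsep : ∀ j l, j ≠ l →
      GSOBI.denom b T₁ T₂ (GSOBI.linCorr P x) (GSOBI.quadCorr P x) j l ≠ 0) :
    ∃ r : ℝ, 0 < r ∧
      -- existence, as a measurable function of the observations `x_1, …, x_n`
      (∃ G : (n : ℕ) → (Fin n → Fin p → ℝ) → Matrix (Fin p) (Fin p) ℝ,
        (∀ n i j, Measurable (fun d => G n d i j)) ∧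
        GSOBI.IsEstimator P b T₁ T₂ x r
          (fun n ω => G n (fun k => x (((k : ℕ) : ℤ) + 1) ω))) ∧
      ∀ Γ : ℕ → Ω → Matrix (Fin p) (Fin p) ℝ, GSOBI.IsEstimator P b T₁ T₂ x r Γ →
        -- consistency
        (∀ j l, TendstoInMeasure P (fun n ω => Γ n ω j l) atTop
          (fun _ => (1 : Matrix (Fin p) (Fin p) ℝ) j l)) ∧
        -- expansions, when the statistics occurring in them are root-n consistent
        ((∀ j l, GSOBI.BddInProb P (fun (n : ℕ) ω =>
            √(n : ℝ) * (GSOBI.sampleCov n (fun t => x t ω) j l - if j = l then 1 else 0))) →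
          (∀ j l, j ≠ l → GSOBI.BddInProb P (fun (n : ℕ) ω =>
            √(n : ℝ) * GSOBI.Tvec b T₁ T₂ n (fun t => x t ω) j l)) →
          (∀ j, TendstoInMeasure P (fun (n : ℕ) ω =>
            √(n : ℝ) * (Γ n ω j j - 1)
              - (-(1 / 2) * (√(n : ℝ) * (GSOBI.sampleCov n (fun t => x t ω) j j - 1))))
            atTop (fun _ => (0 : ℝ))) ∧
          (∀ j l, j ≠ l → TendstoInMeasure P (fun (n : ℕ) ω =>
            √(n : ℝ) * Γ n ω j l
              - (√(n : ℝ) * GSOBI.Tvec b T₁ T₂ n (fun t => x t ω) j l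
                  - √(n : ℝ) * GSOBI.Tvec b T₁ T₂ n (fun t => x t ω) l j
                  + GSOBI.covCoeff b T₁ T₂ (GSOBI.linCorr P x) (GSOBI.quadCorr P x) j l
                    * (√(n : ℝ) * GSOBI.sampleCov n (fun t => x t ω) j l))
                * (GSOBI.denom b T₁ T₂ (GSOBI.linCorr P x) (GSOBI.quadCorr P x) j l)⁻¹)
            atTop (fun _ => (0 : ℝ)))) :=
  theorem1_general P b T₁ T₂ x hmeas herg hmom hmean hcov hindep hsep
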